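/- For $t\in(1,2]$ and $c\in(-1,1)$ let $f=f_{t,c}$ be the affine Lorenz map $f(x)=tx+(t-1)$ for $x\in[-1,c)$ and $f(x)=tx-(t-1)$ for $x\in(c,1]$. Put $c_{1,1}=\lim_{x\uparrow c}f(x)=tc+(t-1)$, $c_{1,2}=\lim_{x\downarrow c}f(x)=tc-(t-1)$ and $\mathbf c_1=(c_{1,1},c_{1,2})$. Assume that $c^-$ and $c^+$ are both periodic or eventually periodic: for $j=1,2$, some iterate of $c_{1,j}$ under $f$ is equal to $c$ or lies on a periodic orbit of $f$. Deformation. For $w=(w_1,w_2)\in\mathbb C^2$ near $\mathbf c_1$ put $t(w)=1+\frac{w_1-w_2}{2}$, $p(w)=\frac{w_1+w_2}{2t(w)}$, and let $G_w(z)=t(w)z+(t(w)-1)$ for $\operatorname{Re}z<c$ and $G_w(z)=t(w)z-(t(w)-1)$ for $\operatorname{Re}z>c$. Thus $p(\mathbf c_1)=c$; write $g=G_{\mathbf c_1}$, which extends $f$. Let $X$ be the finite set consisting of the forward orbits of $c_{1,1}$ and $c_{1,2}$ under $g$, each stopped when it first reaches $c$ (the point $c$ being included in that case). Transfer operator. A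 holomorphic motion of $X$ over a domain $\Lambda\subset\mathbb C$ with base point $*\in\Lambda$ is a family of injections $h_\lambda:X\to\mathbb C$, $\lambda\in\Lambda$, holomorphic in $\lambda$, with $h_*=\mathrm{id}$. Write $\mathbf c_1(\lambda)=(h_\lambda(c_{1,1}),h_\lambda(c_{1,2}))$. A lift of $h_\lambda$ is a holomorphic motion $\hat h_\lambda$ of $X$ over a subdomain $\Lambda_0\subset\Lambda$ containing $*$ such that, for $\lambda$ close to $*$, $\hat h_\lambda(c)=p(\mathbf c_1(\lambda))$ if $c\in X$, and $G_{\mathbf c_1(\lambda)}(\hat h_\lambda(x))=h_\lambda(g(x))$ for every $x\in X\setminus\{c\}$. The transfer operator is the linear map $\mathcal A:\mathbb C^{X}\to\mathbb C^{X}$ such that $$\mathcal A\Big(\big(\tfrac{d}{d\lambda}h_\lambda(x)\big|_{\lambda=*}\big)_{x\in X}\Big)=\big(\tfrac{d}{d\lambda}\hat h_\lambda(x)\big|_{\lambda=*}\big)_{x\in X}$$ whenever $\hat h_\lambda$ is a lift of $h_\lambda$. Critical relations. For each $j\in\{1,2\}$, if the orbit of $c_{1,j}$ reaches $c$, let $q_j\ge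 1$ be minimal with $g^{q_j-1}(c_{1,j})=c$ and put $R_j(w)=G_w^{q_j-1}(w_j)-p(w)$; otherwise let $1\le l_j<q_j$ be minimal with $g^{q_j-1}(c_{1,j})=g^{l_j-1}(c_{1,j})$ and put $R_j(w)=G_w^{q_j-1}(w_j)-G_w^{l_j-1}(w_j)$. Let $\mathcal R=(R_1,R_2)$, a holomorphic map near $\mathbf c_1$. Theorem. The transfer operator $\mathcal A$ exists and is unique, its spectral radius is at most $1$, and $1$ is not an eigenvalue of $\mathcal A$. Moreover the two-parameter family has the positively oriented transversality property at $(t,c)$: $$\frac{\det\big(D\mathcal R(\mathbf c_1)\big)}{\prod_{j=1}^{2}Dg^{\,q_j-1}(c_{1,j})}>0 .$$ -/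

import Mathlib

noncomputable section

namespace LorenzTransversality

open Filter Topology

/-- The forward orbits of the points `c1 j` under `g`, each continued until it first meets the set
of the points `c0 j` (that point included). -/
inductive PostOrbit {ν : ℕ} (c0 c1 : Fin ν → ℂ) (g : ℂ → ℂ) : ℂ → Prop
  | value (j : Fin ν) : PostOrbit c0 c1 g (c1 j)
  | step (x : ℂ) : PostOrbit c0 c1 g x → x ∉ Set.range c0 → PostOrbit c0 c1 g (g x)

/-- A marked map with `ν` marked points `c0 j` and a holomorphic part `g` on the open set `U`.
Two marked points may sit at the same point of `ℂ` (as `c⁻` and `c⁺` do for a map which jumps at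
`c`); so the value `c1 j` of the map at the `j`-th marked point is recorded separately.
`P₀` is `Set.range c0`; the forward invariant set `P` is the union of `P₀` and of the forward orbits
of the `c1 j`, and `g(P)` is the set `PostOrbit c0 c1 g`. -/
structure MarkedMap (ν : ℕ) where
  c0 : Fin ν → ℂ
  c1 : Fin ν → ℂ
  U : Set ℂ
  g : ℂ → ℂ
  isOpen_U : IsOpen U
  differentiableOn_g : DifferentiableOn ℂ g U
  finite_post : {x | PostOrbit c0 c1 g x}.Finite
  post_mem_U : ∀ x, PostOrbit c0 c1 g x → x ∉ Set.range c0 → x ∈ U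
  deriv_ne_zero : ∀ x, PostOrbit c0 c1 g x → x ∉ Set.range c0 → deriv g x ≠ 0

namespace MarkedMap

variable {ν : ℕ} (m : MarkedMap ν)

/-- The set `g(P)`. -/
def gP : Set ℂ := {x | PostOrbit m.c0 m.c1 m.g x}

/-- `c_{1,j}` as a point of `g(P)`. -/
def val (j : Fin ν) : m.gP := ⟨m.c1 j, PostOrbit.value j⟩

/-- `g(x)` as a point of `g(P)`, for `x ∈ g(P) \ P₀`. -/
def next (x : m.gP) (hx : (x : ℂ) ∉ Set.range m.c0) : m.gP :=
  ⟨m.g x, PostOrbit.step x x.2 hx⟩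

end MarkedMap

/-- A local holomorphic deformation `(g, G, p)_W` of a marked map. Marked points at the same place
of the plane are moved together. -/
structure Deformation {ν : ℕ} (m : MarkedMap ν) where
  W : Set (Fin ν → ℂ)
  isOpen_W : IsOpen W
  isConnected_W : IsConnected W
  c1_mem_W : m.c1 ∈ W
  p : (Fin ν → ℂ) → Fin ν → ℂ
  differentiableOn_p : DifferentiableOn ℂ p W
  p_c1 : p m.c1 = m.c0
  p_eq : ∀ w ∈ W, ∀ i j, m.c0 i = m.c0 j → p w i = p w j
  G : (Fin ν → ℂ) → ℂ → ℂ
  differentiableOn_G : DifferentiableOn ℂ (fun x : (Fin ν → ℂ) × ℂ => G x.1 x.2) (W ×ˢ m.U)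
  G_c1 : ∀ z ∈ m.U, G m.c1 z = m.g z

/-- A holomorphic motion of `g(P)` over the pointed domain `(Λ, a)`. -/
structure IsHolomorphicMotion {ν : ℕ} (m : MarkedMap ν) (Λ : Set ℂ) (a : ℂ)
    (h : ℂ → m.gP → ℂ) : Prop where
  isOpen : IsOpen Λ
  isConnected : IsConnected Λ
  base_mem : a ∈ Λ
  injective : ∀ l ∈ Λ, Function.Injective (h l)
  base : ∀ x, h a x = x
  holomorphic : ∀ x, DifferentiableOn ℂ (fun l => h l x) Λ

/-- The two equations of a lift `h'` of `h`, for parameters close to the base point `a`. -/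
def IsLift {ν : ℕ} {m : MarkedMap ν} (D : Deformation m) (a : ℂ) (h h' : ℂ → m.gP → ℂ) : Prop :=
  ∀ᶠ l in 𝓝 a,
    (∀ (j : Fin ν) (x : m.gP), (x : ℂ) = m.c0 j → h' l x = D.p (fun k => h l (m.val k)) j) ∧
    (∀ (x : m.gP) (hx : (x : ℂ) ∉ Set.range m.c0),
      D.G (fun k => h l (m.val k)) (h' l x) = h l (m.next x hx))

/-- The linear map `A` on `ℂ^{g(P)}` is the transfer operator of the deformation: it sends the
velocity at the base point of any holomorphic motion to the velocity of any lift of it. -/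
def IsTransferOperator {ν : ℕ} {m : MarkedMap ν} (D : Deformation m)
    (A : Module.End ℂ (m.gP → ℂ)) : Prop :=
  ∀ (a : ℂ) (Λ Λ₀ : Set ℂ) (h h' : ℂ → m.gP → ℂ), Λ₀ ⊆ Λ →
    IsHolomorphicMotion m Λ a h → IsHolomorphicMotion m Λ₀ a h' → IsLift D a h h' →
      A (fun x => deriv (fun l => h l x) a) = fun x => deriv (fun l => h' l x) a

/-- The two kinds of critical relations: `periodic q μ` stands for `g^q(c_{0,j}) = c_{0,μ}` and
`preperiodic l q` for `g^q(c_{0,j}) = g^l(c_{0,j})`. -/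
inductive Relation (ν : ℕ)
  | periodic (q : ℕ) (μ : Fin ν)
  | preperiodic (l q : ℕ)

/-- The number `q_j` of a relation. -/
def Relation.time {ν : ℕ} : Relation ν → ℕ
  | .periodic q _ => q
  | .preperiodic _ q => q

/-- The relation satisfied by the `j`-th marked point. Here `g^k(c_{0,j}) = g^{k-1}(c_{1,j})`
for `k ≥ 1`. -/
def MarkedMap.Satisfies {ν : ℕ} (m : MarkedMap ν) (j : Fin ν) : Relation ν → Prop
  | .periodic q μ => 1 ≤ q ∧ m.g^[q - 1] (m.c1 j) = m.c0 μ ∧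
      ∀ k, 1 ≤ k → k < q → m.g^[k - 1] (m.c1 j) ∉ Set.range m.c0
  | .preperiodic l q => 1 ≤ l ∧ l < q ∧ m.g^[q - 1] (m.c1 j) = m.g^[l - 1] (m.c1 j) ∧
      (∀ k, 1 ≤ k → k ≤ q → m.g^[k - 1] (m.c1 j) ∉ Set.range m.c0) ∧
      ∀ l' q', 1 ≤ l' → l' < q' → m.g^[q' - 1] (m.c1 j) = m.g^[l' - 1] (m.c1 j) →
        l ≤ l' ∧ q ≤ q'

/-- The map `R = (R_1, …, R_ν)` of the critical relations `rel`. -/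
def Deformation.R {ν : ℕ} {m : MarkedMap ν} (D : Deformation m) (rel : Fin ν → Relation ν)
    (w : Fin ν → ℂ) (j : Fin ν) : ℂ :=
  match rel j with
  | .periodic q μ => (D.G w)^[q - 1] (w j) - D.p w μ
  | .preperiodic l q => (D.G w)^[q - 1] (w j) - (D.G w)^[l - 1] (w j)

/-- The 'positively oriented' transversality property: every marked point satisfies a critical
relation, and for the relations which they satisfy the number
`det DR(c₁) / ∏ⱼ Dg^{q_j - 1}(c_{1,j})` is real and positive. -/
def Deformation.PositivelyTransversal {ν : ℕ} {m : MarkedMap ν} (D : Deformation m) : Prop :=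
  (∃ rel : Fin ν → Relation ν, ∀ j, m.Satisfies j (rel j)) ∧
  ∀ rel : Fin ν → Relation ν, (∀ j, m.Satisfies j (rel j)) →
    ∃ (L : (Fin ν → ℂ) →L[ℂ] (Fin ν → ℂ)) (r : ℝ), HasFDerivAt (D.R rel) L m.c1 ∧ 0 < r ∧
      LinearMap.det (L : (Fin ν → ℂ) →ₗ[ℂ] (Fin ν → ℂ)) /
        ∏ j, deriv (m.g^[(rel j).time - 1]) (m.c1 j) = (r : ℂ)

/-- The affine Lorenz map `f_{t,c}`; the value at the jump `c` is a convention. A point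
outside `[-1, 1]` escapes monotonically to `±∞`, so it is neither periodic nor mapped to `c`. -/
def lorenz (t c x : ℝ) : ℝ :=
  if x < c then t * x + (t - 1) else t * x - (t - 1)

/-- The one-sided critical values `f(c⁻)` (index `0`) and `f(c⁺)` (index `1`). -/
def criticalValue (t c : ℝ) : Fin 2 → ℝ :=
  ![t * c + (t - 1), t * c - (t - 1)]

/-- Some iterate of the `j`-th critical value is equal to `c` or lies on a periodic orbit. -/
def IsEventuallyPeriodic (t c : ℝ) (j : Fin 2) : Prop :=
  ∃ n : ℕ, (lorenz t c)^[n] (criticalValue t c j) = c ∨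
    (lorenz t c)^[n] (criticalValue t c j) ∈ Function.periodicPts (lorenz t c)

/-- The slope `t = 1 + (w₁ - w₂) / 2` as a function of the critical values. -/
def slope (w : Fin 2 → ℂ) : ℂ := 1 + (w 0 - w 1) / 2

/-- The position `(w₁ + w₂) / (2 t)` of the jump as a function of the critical values. -/
def jump (w : Fin 2 → ℂ) : ℂ := (w 0 + w 1) / (2 * slope w)

/-- The two affine branches `G₋` (left of `c`) and `G₊` (right of `c`). -/
def branches (c : ℝ) (w : Fin 2 → ℂ) (z : ℂ) : ℂ :=
  if z.re < c then slope w * z + (slope w - 1) else slope w * z - (slope w - 1)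

/-- The complex critical values. -/
def cval (t c : ℝ) (j : Fin 2) : ℂ := (criticalValue t c j : ℂ)

theorem slope_cval (t c : ℝ) : slope (cval t c) = t := by
  simp [slope, cval, criticalValue]

theorem jump_cval (t c : ℝ) (ht : 1 < t) : jump (cval t c) = c := by
  have h : (t : ℂ) ≠ 0 := by exact_mod_cast (by linarith : t ≠ 0)
  rw [jump, slope_cval]
  simp [cval, criticalValue]
  field_simp
  ring

theorem branches_ofReal (t c x : ℝ) :
    branches c (cval t c) (x : ℂ) = (lorenz t c x : ℂ) := by
  simp only [branches, slope_cval, lorenz, Complex.ofReal_re]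
  split_ifs <;> push_cast <;> ring

theorem isOpen_domain (c : ℝ) : IsOpen {z : ℂ | z.re ≠ c} :=
  isOpen_ne_fun Complex.continuous_re continuous_const

theorem branches_hasDerivAt (c : ℝ) (w : Fin 2 → ℂ) (z : ℂ) (hz : z.re ≠ c) :
    HasDerivAt (branches c w) (slope w) z := by
  rcases lt_or_gt_of_ne hz with h | h
  · have h1 : HasDerivAt (fun z : ℂ => slope w * z + (slope w - 1)) (slope w) z := by
      simpa using ((hasDerivAt_id z).const_mul (slope w)).add_const (slope w - 1)
    refine h1.congr_of_eventuallyEq ?_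
    filter_upwards [(isOpen_lt Complex.continuous_re continuous_const).mem_nhds h] with y hy
    exact if_pos hy
  · have h1 : HasDerivAt (fun z : ℂ => slope w * z - (slope w - 1)) (slope w) z := by
      simpa using ((hasDerivAt_id z).const_mul (slope w)).sub_const (slope w - 1)
    refine h1.congr_of_eventuallyEq ?_
    filter_upwards [(isOpen_lt continuous_const Complex.continuous_re).mem_nhds h] with y hy
    exact if_neg (not_lt.mpr (le_of_lt hy))

theorem differentiable_slope : Differentiable ℂ slope := by
  unfold slope; fun_prop

theorem branches_differentiableOn (c : ℝ) (W : Set (Fin 2 → ℂ)) :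
    DifferentiableOn ℂ (fun x : (Fin 2 → ℂ) × ℂ => branches c x.1 x.2)
      (W ×ˢ {z : ℂ | z.re ≠ c}) := by
  have hs : Differentiable ℂ (fun x : (Fin 2 → ℂ) × ℂ => slope x.1) :=
    differentiable_slope.comp differentiable_fst
  rintro ⟨w, z⟩ ⟨-, hz⟩
  apply DifferentiableAt.differentiableWithinAt
  have hc : Continuous (fun x : (Fin 2 → ℂ) × ℂ => x.2.re) := by fun_prop
  rcases lt_or_gt_of_ne (show z.re ≠ c from hz) with h | h
  · have h1 : Differentiable ℂ
        (fun x : (Fin 2 → ℂ) × ℂ => slope x.1 * x.2 + (slope x.1 - 1)) := by fun_prop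
    refine (h1 (w, z)).congr_of_eventuallyEq ?_
    filter_upwards [(isOpen_lt hc continuous_const).mem_nhds (show (w, z).2.re < c from h)]
      with y hy
    exact if_pos hy
  · have h1 : Differentiable ℂ
        (fun x : (Fin 2 → ℂ) × ℂ => slope x.1 * x.2 - (slope x.1 - 1)) := by fun_prop
    refine (h1 (w, z)).congr_of_eventuallyEq ?_
    filter_upwards [(isOpen_lt continuous_const hc).mem_nhds (show c < (w, z).2.re from h)]
      with y hy
    exact if_neg (not_lt.mpr (le_of_lt hy))

theorem finite_orbit (t c : ℝ) (j : Fin 2) (h : IsEventuallyPeriodic t c j) :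
    {x : ℝ | ∃ n, x = (lorenz t c)^[n] (criticalValue t c j) ∧
      ∀ k < n, (lorenz t c)^[k] (criticalValue t c j) ≠ c}.Finite := by
  set f := lorenz t c
  set v := criticalValue t c j
  obtain ⟨N, hN | hN⟩ := h
  · refine ((Finset.range (N + 1)).finite_toSet.image (fun n => f^[n] v)).subset ?_
    rintro x ⟨n, rfl, hn⟩
    refine ⟨n, ?_, rfl⟩
    simp only [Finset.coe_range, Set.mem_Iio]
    by_contra hlt
    exact hn N (by omega) hN
  · obtain ⟨p, hp, hper⟩ := hN
    refine ((Finset.range (N + p)).finite_toSet.image (fun n => f^[n] v)).subset ?_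
    rintro x ⟨n, rfl, -⟩
    by_cases hnN : n < N + p
    · exact ⟨n, by simpa using hnN, rfl⟩
    · refine ⟨N + (n - N) % p, ?_, ?_⟩
      · have hlt : (n - N) % p < p := Nat.mod_lt _ hp
        simp only [Finset.coe_range, Set.mem_Iio]; omega
      · have h1 : f^[n] v = f^[n - N] (f^[N] v) := by
          rw [← Function.iterate_add_apply]; congr 2; omega
        have h2 : f^[N + (n - N) % p] v = f^[(n - N) % p] (f^[N] v) := by
          rw [← Function.iterate_add_apply, Nat.add_comm]
        show f^[N + (n - N) % p] v = f^[n] v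
        rw [h1, h2, hper.iterate_mod_apply]

theorem post_real (t c : ℝ) {x : ℂ}
    (hx : PostOrbit (fun _ => (c : ℂ)) (cval t c) (branches c (cval t c)) x) :
    ∃ (j : Fin 2) (n : ℕ), x = ((lorenz t c)^[n] (criticalValue t c j) : ℝ) ∧
      ∀ k < n, (lorenz t c)^[k] (criticalValue t c j) ≠ c := by
  induction hx with
  | value j => exact ⟨j, 0, rfl, by simp⟩
  | step x _ hx ih =>
    obtain ⟨j, n, rfl, hn⟩ := ih
    refine ⟨j, n + 1, ?_, ?_⟩
    · rw [branches_ofReal, Function.iterate_succ_apply']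
    · intro k hk
      rcases Nat.lt_succ_iff_lt_or_eq.mp hk with h | rfl
      · exact hn k h
      · intro h
        exact hx ⟨0, by simp [h]⟩

theorem post_re_ne (t c : ℝ) {x : ℂ}
    (hx : PostOrbit (fun _ => (c : ℂ)) (cval t c) (branches c (cval t c)) x)
    (hx' : x ∉ Set.range (fun _ : Fin 2 => (c : ℂ))) : x.re ≠ c := by
  obtain ⟨j, n, rfl, -⟩ := post_real t c hx
  intro h
  apply hx'
  rw [Complex.ofReal_re] at h
  exact ⟨0, by simp [h]⟩

/-- The affine Lorenz map `f_{t,c}` as a marked map with marked points `c⁻` (index `0`) and `c⁺`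
(index `1`), both sitting at `c`. -/
def lorenzMarkedMap (t c : ℝ) (ht : 1 < t) (h : ∀ j, IsEventuallyPeriodic t c j) : MarkedMap 2 where
  c0 := fun _ => (c : ℂ)
  c1 := cval t c
  U := {z : ℂ | z.re ≠ c}
  g := branches c (cval t c)
  isOpen_U := isOpen_domain c
  differentiableOn_g := fun z hz =>
    (branches_hasDerivAt c _ z hz).differentiableAt.differentiableWithinAt
  finite_post := by
    refine ((Set.finite_iUnion fun j => finite_orbit t c j (h j)).image
      (fun x : ℝ => (x : ℂ))).subset ?_
    intro x hx
    obtain ⟨j, n, hx, hn⟩ := post_real t c hx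
    exact ⟨_, Set.mem_iUnion.mpr ⟨j, n, rfl, hn⟩, hx.symm⟩
  post_mem_U := fun _ hx hx' => post_re_ne t c hx hx'
  deriv_ne_zero := fun x hx hx' => by
    rw [(branches_hasDerivAt c _ x (post_re_ne t c hx hx')).deriv, slope_cval]
    exact_mod_cast (by linarith : t ≠ 0)

theorem slope_ne_zero {w : Fin 2 → ℂ} (hw : 0 < (slope w).re) : slope w ≠ 0 := by
  intro h
  simp [h] at hw

/-- The deformation of the Lorenz map parametrised by its two critical values `w`, over the
half-space where the slope has positive real part. -/
def lorenzDeformation (t c : ℝ) (ht : 1 < t) (h : ∀ j, IsEventuallyPeriodic t c j) :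
    Deformation (lorenzMarkedMap t c ht h) where
  W := {w | 0 < (slope w).re}
  isOpen_W := isOpen_lt continuous_const
    (Complex.continuous_re.comp differentiable_slope.continuous)
  isConnected_W := by
    refine ⟨⟨0, by simp [slope]⟩, ?_⟩
    refine Convex.isPreconnected ?_
    intro x hx y hy a b ha hb hab
    have e : (slope (a • x + b • y)).re = a * (slope x).re + b * (slope y).re := by
      simp [slope]
      linear_combination -hab
    change 0 < (slope x).re at hx
    change 0 < (slope y).re at hy
    change 0 < (slope (a • x + b • y)).re
    rw [e]
    rcases ha.eq_or_lt with rfl | ha'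
    · have : b = 1 := by linarith
      subst this; simpa using hy
    · have := mul_pos ha' hx
      have := mul_nonneg hb hy.le
      linarith
  c1_mem_W := by
    show 0 < (slope (cval t c)).re
    rw [slope_cval, Complex.ofReal_re]; linarith
  p := fun w _ => jump w
  differentiableOn_p := by
    rw [differentiableOn_pi]
    intro _ w hw
    have h0 : 2 * slope w ≠ 0 := mul_ne_zero two_ne_zero (slope_ne_zero hw)
    have h1 := differentiable_slope w
    apply DifferentiableAt.differentiableWithinAt
    have h2 : DifferentiableAt ℂ (fun w : Fin 2 → ℂ => w 0 + w 1) w := by fun_prop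
    have h3 : DifferentiableAt ℂ (fun w : Fin 2 → ℂ => 2 * slope w) w := h1.const_mul 2
    have h4 := h2.mul (h3.inv h0)
    exact h4.congr_of_eventuallyEq (Eventually.of_forall fun w => div_eq_mul_inv _ _)
  p_c1 := funext fun _ => jump_cval t c ht
  p_eq := fun _ _ _ _ _ => rfl
  G := branches c
  differentiableOn_G := branches_differentiableOn c _
  G_c1 := fun _ _ => rfl

end LorenzTransversality

end

noncomputable section

namespace LorenzTransversality

open Filter Topology MeasureTheory

/-! On velocities the transfer operator is `A v = (v ∘ f - τ(v) (x + σ(x))) / t`, where `τ(v) =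
(v(c₁,₁) - v(c₁,₂)) / 2` is the velocity of the slope, `σ = ±1` marks the branch, and `c` counts as
`c⁺`.

Spectrum. Let `φ` be a left eigenvector of `A` for an eigenvalue `μ` with `|μ| ≥ 1`. Since `1` and
`x` are eigenvectors of `A` for `1/t < 1`, `φ` kills both. Then `F(y) = φ(1_{y < x})` is a step
function of bounded support and zero mean, and `apply_below` turns `φ ∘ A = μ φ` into `L F = μ t F`,
where `L F(y) = ∑_{f(x) = y} F(x)`. As `L` multiplies integrals by `t`, `|μ| > 1` forces `F = 0`. If
`μ = 1`, the positive set of the real (or imaginary) part of `F` is forward invariant; expansion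
makes it contain `c` unless it is empty, and so does the negative set. Hence that part has constant
sign and, having zero mean, vanishes. Threshold functions span, so `φ = 0`.

Transversality. Let `Φ_s` be the bounded solution of `Φ(f x) = s Φ(x) + x + σ(x)` on the
post-critical set. If `τ(Φ_s) = 1` with `s ≥ t`, then `Φ_s` is an eigenvector of `A` for `s/t ≥ 1`,
which is excluded. As `τ(Φ_s) < 1` for large `s`, continuity gives `τ(Φ_t) < 1`. In the coordinates
`dw_j - Φ_t(c₁,ⱼ) dt` the matrix `DR` is triangular up to a positive factor on each row, and its
determinant is a positive multiple of `1 - τ(Φ_t)`. -/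

/-! ### Right-continuous step functions on the line. -/

/-- A function which is locally constant to the right of every point. -/
def RightStep {E : Type*} (F : ℝ → E) : Prop := ∀ y, ∀ᶠ y' in 𝓝[≥] y, F y' = F y

theorem RightStep.map {E E' : Type*} {F : ℝ → E} (hF : RightStep F) (k : E → E') :
    RightStep fun y => k (F y) :=
  fun y => (hF y).mono fun _ h => congrArg k h

theorem RightStep.map₂ {E₁ E₂ E₃ : Type*} {F : ℝ → E₁} {G : ℝ → E₂} (hF : RightStep F)
    (hG : RightStep G) (k : E₁ → E₂ → E₃) : RightStep fun y => k (F y) (G y) := by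
  intro y
  filter_upwards [hF y, hG y] with y' h1 h2
  rw [h1, h2]

theorem RightStep.comp_affine {E : Type*} {F : ℝ → E} (hF : RightStep F) {a : ℝ} (ha : 0 < a)
    (b : ℝ) : RightStep fun y => F ((y + b) / a) := by
  intro y
  have h : Tendsto (fun y : ℝ => (y + b) / a) (𝓝[≥] y) (𝓝[≥] ((y + b) / a)) := by
    refine tendsto_nhdsWithin_iff.mpr ⟨?_, ?_⟩
    · have : Continuous fun y : ℝ => (y + b) / a := by fun_prop
      exact this.continuousAt.tendsto.mono_left nhdsWithin_le_nhds
    · filter_upwards [self_mem_nhdsWithin] with y' hy'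
      have : y ≤ y' := hy'
      show (y + b) / a ≤ (y' + b) / a
      gcongr
  exact h.eventually (hF _)

theorem rightStep_lt (c : ℝ) : RightStep fun y => y < c := by
  intro y
  by_cases hy : y < c
  · filter_upwards [nhdsWithin_le_nhds (Iio_mem_nhds hy)] with y' hy'
    exact propext ⟨fun _ => hy, fun _ => hy'⟩
  · filter_upwards [self_mem_nhdsWithin] with y' hy'
    have : y ≤ y' := hy'
    exact propext ⟨fun h => this.trans_lt h, fun h => absurd h hy⟩

theorem RightStep.exists_Ico {E : Type*} {F : ℝ → E} (hF : RightStep F) (y : ℝ) :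
    ∃ e > 0, ∀ y' ∈ Set.Ico y (y + e), F y' = F y := by
  obtain ⟨u, hu, h⟩ := mem_nhdsGE_iff_exists_Ico_subset.mp (hF y)
  refine ⟨u - y, sub_pos.mpr hu, fun y' hy' => h ?_⟩
  simpa using hy'

/-- A nonzero value persists on an interval of positive length. This lets integral identities yield
pointwise conclusions. -/
theorem RightStep.eq_zero_of_ae {E : Type*} [Zero E] {F : ℝ → E} (hF : RightStep F)
    (h0 : ∀ᵐ y, F y = 0) (y : ℝ) : F y = 0 := by
  by_contra hy
  obtain ⟨e, he, h⟩ := hF.exists_Ico y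
  have h1 : volume (Set.Ico y (y + e)) = 0 := by
    refine measure_mono_null (fun y' hy' => ?_) (ae_iff.mp h0)
    show ¬ F y' = 0
    rwa [h y' hy']
  rw [Real.volume_Ico] at h1
  simp only [add_sub_cancel_left, ENNReal.ofReal_eq_zero] at h1
  linarith

/-! ### The transfer operator on integrable step functions. -/

/-- The transfer operator `F ↦ ∑_{f(x) = y} F(x)` of the affine Lorenz map on the line. -/
def pushforward {E : Type*} [AddZeroClass E] (t c : ℝ) (F : ℝ → E) (y : ℝ) : E :=
  (if (y + -(t - 1)) / t < c then F ((y + -(t - 1)) / t) else 0) +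
    (if (y + (t - 1)) / t < c then 0 else F ((y + (t - 1)) / t))

theorem RightStep.pushforward {E : Type*} [AddZeroClass E] {t : ℝ} (ht : 0 < t) (c : ℝ)
    {F : ℝ → E} (hF : RightStep F) : RightStep (pushforward t c F) := by
  classical
  have h1 : RightStep fun u => if u < c then F u else 0 :=
    (rightStep_lt c).map₂ hF fun p x => if p then x else 0
  have h2 : RightStep fun u => if u < c then 0 else F u :=
    (rightStep_lt c).map₂ hF fun p x => if p then 0 else x
  exact (h1.comp_affine ht _).map₂ (h2.comp_affine ht _) fun a b => a + b

theorem integral_comp_affine (F : ℝ → ℝ) {t : ℝ} (ht : 0 < t) (b : ℝ) :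
    ∫ y, F ((y + b) / t) = t * ∫ y, F y := by
  rw [integral_add_right_eq_self (fun y => F (y / t)) b, Measure.integral_comp_div, abs_of_pos ht,
    smul_eq_mul]

theorem integrable_comp_affine {F : ℝ → ℝ} (hF : Integrable F) {t : ℝ} (ht : 0 < t) (b : ℝ) :
    Integrable fun y => F ((y + b) / t) :=
  (hF.comp_div ht.ne').comp_add_right b

theorem integrable_restrictions {F : ℝ → ℝ} (hF : Integrable F) (c : ℝ) :
    Integrable (fun u => if u < c then F u else 0) ∧
      Integrable (fun u => if u < c then 0 else F u) := by
  have h1 := hF.indicator (measurableSet_Iio (a := c))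
  have h2 := hF.indicator (measurableSet_Ici (a := c))
  refine ⟨h1.congr (ae_of_all _ fun u => ?_), h2.congr (ae_of_all _ fun u => ?_)⟩
  · simp [Set.indicator_apply]
  · simp only [Set.indicator_apply, Set.mem_Ici]
    split_ifs <;> first | rfl | (exfalso; linarith)

theorem integrable_pushforward {t : ℝ} (ht : 0 < t) (c : ℝ) {F : ℝ → ℝ} (hF : Integrable F) :
    Integrable (pushforward t c F) :=
  (integrable_comp_affine (integrable_restrictions hF c).1 ht _).add
    (integrable_comp_affine (integrable_restrictions hF c).2 ht _)

/-- Each branch stretches lengths by `t`, and the two restrictions of `F` add up to `F`. -/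
theorem integral_pushforward {t : ℝ} (ht : 0 < t) (c : ℝ) {F : ℝ → ℝ} (hF : Integrable F) :
    ∫ y, pushforward t c F y = t * ∫ y, F y := by
  obtain ⟨h1, h2⟩ := integrable_restrictions hF c
  have e := integral_add (integrable_comp_affine h1 ht (-(t - 1)))
    (integrable_comp_affine h2 ht (t - 1))
  rw [integral_comp_affine (fun u => if u < c then F u else 0) ht,
    integral_comp_affine (fun u => if u < c then 0 else F u) ht, ← mul_add,
    ← integral_add h1 h2] at e
  have h3 : (fun u => (if u < c then F u else 0) + (if u < c then 0 else F u)) = F := by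
    funext u; split_ifs <;> simp
  rw [h3] at e
  exact e

theorem norm_pushforward_le {E : Type*} [NormedAddCommGroup E] (t c : ℝ) (F : ℝ → E) (y : ℝ) :
    ‖pushforward t c F y‖ ≤ pushforward t c (fun y => ‖F y‖) y := by
  unfold pushforward
  refine (norm_add_le _ _).trans (le_of_eq ?_)
  congr 1 <;> split_ifs <;> simp

/-- An eigenvalue of the operator `pushforward` on integrable step functions has modulus at
most `t`. -/
theorem eq_zero_of_pushforward_eq_mul {t c : ℝ} (ht : 0 < t) {F : ℝ → ℂ} (hF : RightStep F)
    (hi : Integrable F) {μ : ℂ} (hμ : 1 < ‖μ‖) (h : ∀ y, pushforward t c F y = μ * t * F y)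
    (y : ℝ) : F y = 0 := by
  refine hF.eq_zero_of_ae ?_ y
  -- Together with `integral_pushforward` this reads `|μ| t ∫|F| ≤ t ∫|F|`, so `∫|F| = 0`.
  have h1 : ∫ y, ‖μ‖ * t * ‖F y‖ ≤ ∫ y, pushforward t c (fun y => ‖F y‖) y := by
    refine integral_mono (hi.norm.const_mul _) (integrable_pushforward ht c hi.norm) fun y => ?_
    have := norm_pushforward_le t c F y
    rw [h y, norm_mul, norm_mul, Complex.norm_real, Real.norm_of_nonneg ht.le] at this
    exact this
  rw [integral_const_mul, integral_pushforward ht c hi.norm] at h1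
  have h2 : 0 ≤ ∫ y, ‖F y‖ := integral_nonneg fun y => norm_nonneg _
  have h3 : ∫ y, ‖F y‖ = 0 := by
    by_contra h3
    have h4 : 0 < t * ∫ y, ‖F y‖ := mul_pos ht (lt_of_le_of_ne h2 (Ne.symm h3))
    nlinarith
  have h5 := (integral_eq_zero_iff_of_nonneg (fun y => norm_nonneg (F y)) hi.norm).mp h3
  filter_upwards [h5] with y hy
  simpa using hy

/-- A function fixed by the normalised operator satisfies the same equation in modulus. -/
theorem pushforward_abs {t c : ℝ} (ht : 0 < t) {G : ℝ → ℝ} (hG : RightStep G)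
    (hi : Integrable G) (h : ∀ y, pushforward t c G y = t * G y) (y : ℝ) :
    pushforward t c (fun y => |G y|) y = t * |G y| := by
  have hia : Integrable fun y => |G y| := hi.abs
  have hp := integrable_pushforward ht c hia
  have h1 : ∀ y, 0 ≤ pushforward t c (fun y => |G y|) y - t * |G y| := fun y => by
    have := norm_pushforward_le t c G y
    rw [h y, norm_mul, Real.norm_of_nonneg ht.le] at this
    exact sub_nonneg.mpr this
  -- The triangle inequality holds pointwise and both sides have the same integral, so equality
  -- holds almost everywhere, hence everywhere.
  have h2 : ∫ y, (pushforward t c (fun y => |G y|) y - t * |G y|) = 0 := by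
    rw [integral_sub hp (hia.const_mul t), integral_const_mul, integral_pushforward ht c hia,
      sub_self]
  have h3 := (integral_eq_zero_iff_of_nonneg h1 (hp.sub (hia.const_mul t))).mp h2
  have hs : RightStep fun y => pushforward t c (fun y => |G y|) y - t * |G y| :=
    ((hG.map _).pushforward ht c).map₂ (hG.map fun x => t * |x|) fun a b => a - b
  have := hs.eq_zero_of_ae h3 y
  linarith

/-- An expanding Lorenz map has only one invariant set of intervals: it contains the jump. -/
theorem pos_at_jump {t c B : ℝ} (ht : 1 < t) {G : ℝ → ℝ} (hG : RightStep G)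
    (hi : Integrable G) (hB : ∀ y, G y ≠ 0 → |y| ≤ B)
    (h : ∀ y, pushforward t c G y = t * G y) {y₀ : ℝ} (hy₀ : 0 < G y₀) : 0 < G c := by
  have ht0 : 0 < t := by linarith
  -- The set `{G > 0}` is forward invariant: where `G y ≤ 0`, adding the equations for `G` and `|G|`
  -- shows that the nonnegative `G + |G|` sums to zero over the preimages of `y`.
  have hpos : ∀ y, (((y + -(t - 1)) / t < c ∧ 0 < G ((y + -(t - 1)) / t)) ∨
      (c ≤ (y + (t - 1)) / t ∧ 0 < G ((y + (t - 1)) / t))) → 0 < G y := by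
    intro y hy
    have e1 := h y
    have e2 := pushforward_abs ht0 hG hi h y
    by_contra hneg
    rw [abs_of_nonpos (not_lt.mp hneg)] at e2
    unfold pushforward at e1 e2
    beta_reduce at e2
    rcases hy with ⟨h1, h2⟩ | ⟨h1, h2⟩
    · rw [if_pos h1] at e1 e2
      rw [abs_of_pos h2] at e2
      split_ifs at e1 e2
      · linarith
      · linarith [neg_abs_le (G ((y + (t - 1)) / t))]
    · rw [if_neg (not_lt.mpr h1)] at e1 e2
      rw [abs_of_pos h2] at e2
      split_ifs at e1 e2
      · linarith [neg_abs_le (G ((y + -(t - 1)) / t))]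
      · linarith
  set S : Set ℝ := {l | 0 < l ∧ ∃ a, ∀ y ∈ Set.Ico a (a + l), 0 < G y} with hS
  have hbdd : BddAbove S := by
    refine ⟨2 * B, ?_⟩
    rintro l ⟨hl, a, ha⟩
    by_contra! hlt
    have h1 := abs_le.mp (hB a (ha a ⟨le_rfl, by linarith⟩).ne')
    have h2 := abs_le.mp (hB (a + (l + 2 * B) / 2) (ha _ ⟨by linarith, by linarith⟩).ne')
    linarith
  obtain ⟨e, he, hE⟩ := hG.exists_Ico y₀
  have heS : e ∈ S := ⟨he, y₀, fun y hy => by rw [hE y hy]; exact hy₀⟩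
  have hM : 0 < sSup S := he.trans_le (le_csSup hbdd heS)
  -- An interval of positivity longer than `sSup S / t` cannot lie on one side of `c`: its image
  -- would be longer than `sSup S`.
  obtain ⟨l, ⟨hl, a, ha⟩, hlt⟩ := exists_lt_of_lt_csSup ⟨e, heS⟩ (div_lt_self hM ht)
  rw [div_lt_iff₀ ht0] at hlt
  have hcontra : t * l ∉ S := fun hmem => by
    have := le_csSup hbdd hmem
    linarith
  by_cases h1 : c < a
  · refine absurd ⟨mul_pos ht0 hl, t * a - (t - 1), fun y hy => hpos y (Or.inr ?_)⟩ hcontra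
    have h2 : a ≤ (y + (t - 1)) / t := by rw [le_div_iff₀ ht0]; linarith [hy.1]
    have h3 : (y + (t - 1)) / t < a + l := by rw [div_lt_iff₀ ht0]; linarith [hy.2]
    exact ⟨by linarith, ha _ ⟨h2, h3⟩⟩
  · by_cases h4 : c < a + l
    · exact ha c ⟨not_lt.mp h1, h4⟩
    · refine absurd ⟨mul_pos ht0 hl, t * a + (t - 1), fun y hy => hpos y (Or.inl ?_)⟩ hcontra
      have h2 : a ≤ (y + -(t - 1)) / t := by rw [le_div_iff₀ ht0]; linarith [hy.1]
      have h3 : (y + -(t - 1)) / t < a + l := by rw [div_lt_iff₀ ht0]; linarith [hy.2]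
      exact ⟨by linarith, ha _ ⟨h2, h3⟩⟩

theorem RightStep.exists_pos {G : ℝ → ℝ} (hG : RightStep G) (hi : Integrable G)
    (h0 : ∫ y, G y = 0) {y₀ : ℝ} (hy₀ : G y₀ ≠ 0) : ∃ y, 0 < G y := by
  by_contra! hle
  have h1 : ∫ y, -G y = 0 := by rw [integral_neg, h0, neg_zero]
  have h2 := (integral_eq_zero_iff_of_nonneg (fun y => neg_nonneg.mpr (hle y)) hi.neg).mp h1
  refine hy₀ (hG.eq_zero_of_ae ?_ y₀)
  filter_upwards [h2] with y hy
  simpa using hy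

theorem pushforward_neg (t c : ℝ) (G : ℝ → ℝ) (y : ℝ) :
    pushforward t c (fun y => -G y) y = -pushforward t c G y := by
  unfold pushforward
  split_ifs <;> ring

/-- An integrable step function of zero mean fixed by the normalised operator vanishes. -/
theorem eq_zero_of_pushforward_eq {t c B : ℝ} (ht : 1 < t) {G : ℝ → ℝ} (hG : RightStep G)
    (hi : Integrable G) (hB : ∀ y, G y ≠ 0 → |y| ≤ B)
    (h : ∀ y, pushforward t c G y = t * G y) (h0 : ∫ y, G y = 0) (y : ℝ) : G y = 0 := by
  by_contra hy
  obtain ⟨y₁, h1⟩ := hG.exists_pos hi h0 hy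
  obtain ⟨y₂, h2⟩ := (hG.map fun x => -x).exists_pos hi.neg
    (by rw [integral_neg, h0, neg_zero]) (neg_ne_zero.mpr hy)
  have h3 := pos_at_jump ht hG hi hB h h1
  have h4 := pos_at_jump ht (hG.map fun x => -x) hi.neg
    (fun y hy => hB y (neg_ne_zero.mp hy))
    (fun y => by rw [pushforward_neg, h y]; ring) h2
  linarith

/-! ### The operator on velocities and its action on threshold functions. -/

/-- The sign of the translation part of the branch at `x`. -/
def side (c x : ℝ) : ℝ := if x < c then 1 else -1

theorem lorenz_eq (t c x : ℝ) : lorenz t c x = t * x + side c x * (t - 1) := by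
  unfold lorenz side; split_ifs <;> ring

/-- The operator `v ↦ (v ∘ f - τ(v) (x + σ(x))) / t` on functions on a finite invariant set,
where `τ(v)` is the velocity of the slope. -/
structure IsAffineTransfer {ι : Type*} (t c : ℝ) (pos : ι → ℝ) (next : ι → ι) (k : Fin 2 → ι)
    (A : Module.End ℂ (ι → ℂ)) : Prop where
  pos_next : ∀ i, pos (next i) = lorenz t c (pos i)
  pos_k : ∀ j, pos (k j) = criticalValue t c j
  injective : Function.Injective pos
  apply : ∀ v i, A v i =
    (v (next i) - (v (k 0) - v (k 1)) / 2 * ((pos i : ℂ) + side c (pos i))) / t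

/-- The functions `1_{y < x}` of `x`. -/
def below {ι : Type*} (pos : ι → ℝ) (y : ℝ) (i : ι) : ℂ := if y < pos i then 1 else 0

namespace IsAffineTransfer

variable {ι : Type*} {t c : ℝ} {pos : ι → ℝ} {next : ι → ι} {k : Fin 2 → ι}
  {A : Module.End ℂ (ι → ℂ)}

theorem apply_one (h : IsAffineTransfer t c pos next k A) : A 1 = (t : ℂ)⁻¹ • (1 : ι → ℂ) := by
  funext i
  simp [h.apply]

theorem apply_pos (h : IsAffineTransfer t c pos next k A) (ht : t ≠ 0) :
    A (fun i => (pos i : ℂ)) = (t : ℂ)⁻¹ • fun i => (pos i : ℂ) := by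
  have ht' : (t : ℂ) ≠ 0 := by exact_mod_cast ht
  funext i
  simp only [h.apply, h.pos_next, h.pos_k, lorenz_eq, criticalValue, Pi.smul_apply, smul_eq_mul]
  simp
  field_simp
  ring

/-- Counting preimages of `y` below `x` gives `1_{y < f(x)}`, plus `Δ = 1_{y < c₁,₁} - 1_{y < c₁,₂}`
when `x ≥ c`. Since `1_{x ≥ c} = (1 - σ(x)) / 2`, the terms in `σ` cancel and only a multiple of `x
+ 1` remains, which the left eigenvectors in question annihilate. -/
theorem apply_below (h : IsAffineTransfer t c pos next k A) (ht : 0 < t) (y : ℝ) :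
    (t : ℂ) • A (below pos y) = pushforward t c (below pos) y -
      ((below pos y (k 0) - below pos y (k 1)) / 2) • ((fun i => (pos i : ℂ)) + 1) := by
  have ht' : (t : ℂ) ≠ 0 := by exact_mod_cast ht.ne'
  have e1 : (y + -(t - 1)) / t < c ↔ y < criticalValue t c 0 := by
    rw [div_lt_iff₀ ht]; simp only [criticalValue, Matrix.cons_val_zero]
    constructor <;> intro h <;> linarith
  have e2 : (y + (t - 1)) / t < c ↔ y < criticalValue t c 1 := by
    rw [div_lt_iff₀ ht]; simp only [criticalValue, Matrix.cons_val_one, Matrix.cons_val_fin_one]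
    constructor <;> intro h <;> linarith
  funext i
  have e3 : (y + -(t - 1)) / t < pos i ↔ y < t * pos i + (t - 1) := by
    rw [div_lt_iff₀ ht]
    constructor <;> intro h <;> linarith
  have e4 : (y + (t - 1)) / t < pos i ↔ y < t * pos i - (t - 1) := by
    rw [div_lt_iff₀ ht]
    constructor <;> intro h <;> linarith
  have e6 : below pos ((y + -(t - 1)) / t) i = if y < t * pos i + (t - 1) then 1 else 0 := by
    simp only [below, e3]
  have e7 : below pos ((y + (t - 1)) / t) i = if y < t * pos i - (t - 1) then 1 else 0 := by
    simp only [below, e4]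
  have e8 : pushforward t c (below pos) y i =
      (if y < criticalValue t c 0 then (if y < t * pos i + (t - 1) then 1 else 0) else 0) +
      (if y < criticalValue t c 1 then 0 else (if y < t * pos i - (t - 1) then 1 else 0)) := by
    unfold pushforward
    rw [Pi.add_apply, ← e6, ← e7]
    simp only [e1, e2]
    congr 1 <;> split_ifs <;> rfl
  rw [Pi.smul_apply, h.apply, Pi.sub_apply, e8, smul_eq_mul, mul_div_cancel₀ _ ht']
  simp only [below, h.pos_next, h.pos_k, Pi.smul_apply, Pi.add_apply, Pi.one_apply, smul_eq_mul,
    lorenz, side]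
  by_cases hi : pos i < c
  · have m1 := mul_lt_mul_of_pos_left hi ht
    simp only [if_pos hi]
    have a1 : y < t * pos i + (t - 1) → y < criticalValue t c 0 := by
      intro h; simp [criticalValue]; linarith
    have a2 : y < t * pos i - (t - 1) → y < criticalValue t c 1 := by
      intro h; simp [criticalValue]; linarith
    by_cases b1 : y < t * pos i + (t - 1) <;> by_cases b2 : y < t * pos i - (t - 1) <;>
      by_cases b3 : y < criticalValue t c 0 <;> by_cases b4 : y < criticalValue t c 1 <;>
      first
      | exact absurd (a1 b1) b3
      | exact absurd (a2 b2) b4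
      | (simp only [b1, b2, b3, b4, if_true, if_false]; push_cast; ring)
  · have m1 := mul_le_mul_of_nonneg_left (not_lt.mp hi) ht.le
    simp only [if_neg hi]
    have a1 : y < criticalValue t c 0 → y < t * pos i + (t - 1) := by
      intro h; simp [criticalValue] at h; linarith
    have a2 : y < criticalValue t c 1 → y < t * pos i - (t - 1) := by
      intro h; simp [criticalValue] at h; linarith
    by_cases b1 : y < t * pos i + (t - 1) <;> by_cases b2 : y < t * pos i - (t - 1) <;>
      by_cases b3 : y < criticalValue t c 0 <;> by_cases b4 : y < criticalValue t c 1 <;>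
      first
      | exact absurd (a1 b3) b1
      | exact absurd (a2 b4) b2
      | (simp only [b1, b2, b3, b4, if_true, if_false]; push_cast; ring)

/-- A left eigenvector. -/
theorem _root_.Module.End.HasEigenvalue.exists_dual {V : Type*} [AddCommGroup V] [Module ℂ V]
    [FiniteDimensional ℂ V] {T : Module.End ℂ V} {μ : ℂ} (h : T.HasEigenvalue μ) :
    ∃ φ : V →ₗ[ℂ] ℂ, φ ≠ 0 ∧ ∀ v, φ (T v) = μ * φ v := by
  obtain ⟨v, hv⟩ := h.exists_hasEigenvector
  -- In finite dimension `T - μ` is not injective, hence not surjective; a functional vanishing on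
  -- its range is a left eigenvector.
  have hlt : LinearMap.range (T - algebraMap ℂ (Module.End ℂ V) μ) < ⊤ := by
    refine lt_top_iff_ne_top.mpr fun hr => hv.2 ?_
    have hinj := LinearMap.injective_iff_surjective.mpr (LinearMap.range_eq_top.mp hr)
    apply hinj
    rw [map_zero, LinearMap.sub_apply, hv.apply_eq_smul, Module.algebraMap_end_apply, sub_self]
  obtain ⟨φ, hφ, hle⟩ := Submodule.exists_le_ker_of_lt_top _ hlt
  refine ⟨φ, hφ, fun v => ?_⟩
  have := hle ⟨v, rfl⟩
  rw [LinearMap.mem_ker, LinearMap.sub_apply, map_sub, Module.algebraMap_end_apply, map_smul,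
    smul_eq_mul] at this
  exact sub_eq_zero.mp this

/-- Left and right eigenvectors with different eigenvalues are orthogonal, and `|1/t| < 1 ≤ |μ|`.
The correction term of `apply_below` therefore disappears under `φ`. -/
theorem pushforward_dual (h : IsAffineTransfer t c pos next k A) (ht : 1 < t) {μ : ℂ}
    (hμ : 1 ≤ ‖μ‖) {φ : (ι → ℂ) →ₗ[ℂ] ℂ} (hφ : ∀ v, φ (A v) = μ * φ v) :
    φ 1 = 0 ∧ φ (fun i => (pos i : ℂ)) = 0 ∧
      ∀ y, pushforward t c (fun y => φ (below pos y)) y = μ * t * φ (below pos y) := by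
  have ht0 : (0 : ℝ) < t := by linarith
  have hne : (t : ℂ)⁻¹ - μ ≠ 0 := by
    intro e
    have e' : ‖(t : ℂ)⁻¹‖ = ‖μ‖ := by rw [sub_eq_zero.mp e]
    rw [norm_inv, Complex.norm_real, Real.norm_of_nonneg ht0.le] at e'
    have := inv_lt_one_of_one_lt₀ ht
    linarith
  have h1 : φ 1 = 0 := by
    have := hφ 1
    rw [h.apply_one, map_smul, smul_eq_mul] at this
    exact (mul_eq_zero.mp (by linear_combination this :
      ((t : ℂ)⁻¹ - μ) * φ 1 = 0)).resolve_left hne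
  have h2 : φ (fun i => (pos i : ℂ)) = 0 := by
    have := hφ fun i => (pos i : ℂ)
    rw [h.apply_pos ht0.ne', map_smul, smul_eq_mul] at this
    exact (mul_eq_zero.mp (by linear_combination this :
      ((t : ℂ)⁻¹ - μ) * φ (fun i => (pos i : ℂ)) = 0)).resolve_left hne
  refine ⟨h1, h2, fun y => ?_⟩
  have h3 := congrArg φ (h.apply_below ht0 y)
  rw [map_smul, hφ, map_sub, map_smul, map_add, h1, h2, add_zero, smul_zero, sub_zero,
    smul_eq_mul] at h3
  rw [show μ * t * φ (below pos y) = t * (μ * φ (below pos y)) by ring, h3]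
  unfold pushforward
  rw [map_add]
  split_ifs <;> simp

end IsAffineTransfer

/-! ### Functionals evaluated on threshold functions. -/

section StepFunctions

variable {ι : Type*} {pos : ι → ℝ}

theorem rightStep_below [Finite ι] (pos : ι → ℝ) : RightStep (below pos) := by
  classical
  intro y
  have : ∀ᶠ y' in 𝓝[≥] y, ∀ i, (y' < pos i) = (y < pos i) :=
    eventually_all.mpr fun i => rightStep_lt (pos i) y
  filter_upwards [this] with y' hy'
  funext i
  simp only [below, hy' i]

theorem exists_bound [Finite ι] (pos : ι → ℝ) : ∃ B, ∀ i, |pos i| < B := by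
  obtain ⟨B, hB⟩ := (Set.finite_range fun i => |pos i|).bddAbove
  exact ⟨B + 1, fun i => by linarith [hB ⟨i, rfl⟩]⟩

theorem below_eq_zero {B : ℝ} (hB : ∀ i, |pos i| < B) {y : ℝ} (hy : B < y) : below pos y = 0 := by
  funext i
  exact if_neg (by linarith [(abs_lt.mp (hB i)).2])

theorem below_eq_one {B : ℝ} (hB : ∀ i, |pos i| < B) {y : ℝ} (hy : y < -B) : below pos y = 1 := by
  funext i
  exact if_pos (by linarith [(abs_lt.mp (hB i)).1])

theorem dual_below_support {φ : (ι → ℂ) →ₗ[ℂ] ℂ} (h1 : φ 1 = 0) {B : ℝ}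
    (hB : ∀ i, |pos i| < B) {y : ℝ} (hy : φ (below pos y) ≠ 0) : |y| ≤ B := by
  refine abs_le.mpr ⟨?_, ?_⟩ <;> by_contra! hlt <;> apply hy
  · rw [below_eq_one hB hlt, h1]
  · rw [below_eq_zero hB hlt, map_zero]

/-- Cutting at `-B` makes every summand integrable. It costs nothing, because left of `-B` the
threshold function is `1`, which `φ` kills. -/
theorem dual_below_eq_sum [Fintype ι] [DecidableEq ι] {φ : (ι → ℂ) →ₗ[ℂ] ℂ} (h1 : φ 1 = 0) {B : ℝ}
    (hB : ∀ i, |pos i| < B) (y : ℝ) : φ (below pos y) =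
      ∑ i, φ (Pi.single i 1) * (Set.Ico (-B) (pos i)).indicator (fun _ => (1 : ℂ)) y := by
  have key : ∀ v : ι → ℂ, φ v = ∑ i, φ (Pi.single i 1) * v i := by
    intro v
    conv_lhs => rw [LinearMap.pi_apply_eq_sum_univ φ v]
    refine Finset.sum_congr rfl fun i _ => ?_
    rw [smul_eq_mul, mul_comm]
    congr 2
    funext j
    simp [Pi.single_apply, eq_comm]
  by_cases hy : y < -B
  · rw [below_eq_one hB hy, h1, Finset.sum_eq_zero]
    intro i _
    rw [Set.indicator_of_notMem (fun h => absurd h.1 (not_le.mpr hy)), mul_zero]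
  · rw [key]
    refine Finset.sum_congr rfl fun i _ => ?_
    simp only [below, Set.indicator_apply, Set.mem_Ico, not_lt.mp hy, true_and]

/-- The interval `[-B, pos i)` has length `pos i + B`, and the contribution of the constant `B`
vanishes because `φ 1 = 0`. -/
theorem integrable_dual_below [Finite ι] {φ : (ι → ℂ) →ₗ[ℂ] ℂ} (h1 : φ 1 = 0) :
    Integrable (fun y => φ (below pos y)) ∧
      ∫ y, φ (below pos y) = φ (fun i => (pos i : ℂ)) := by
  classical
  have := Fintype.ofFinite ι
  obtain ⟨B, hB⟩ := exists_bound pos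
  have hi : ∀ i, Integrable fun y : ℝ =>
      φ (Pi.single i 1) * (Set.Ico (-B) (pos i)).indicator (fun _ => (1 : ℂ)) y := fun i =>
    Integrable.const_mul ((integrable_indicator_iff measurableSet_Ico).mpr
      (integrableOn_const (by simp))) _
  simp only [dual_below_eq_sum h1 hB]
  refine ⟨integrable_finsetSum _ fun i _ => hi i, ?_⟩
  rw [integral_finsetSum _ fun i _ => hi i]
  have e : (fun i => (pos i : ℂ)) = ∑ i, ((pos i + B : ℝ) : ℂ) • Pi.single i (1 : ℂ) - (B : ℂ) • 1 := by
    funext j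
    simp [Finset.sum_apply, Pi.single_apply]
  rw [e, map_sub, map_smul, h1, smul_zero, sub_zero, map_sum]
  refine Finset.sum_congr rfl fun i _ => ?_
  rw [integral_const_mul, integral_indicator measurableSet_Ico, map_smul, smul_eq_mul, mul_comm]
  have := (abs_lt.mp (hB i)).1
  simp [Measure.real, Real.volume_Ico]
  left
  rw [ENNReal.toReal_ofReal (by linarith)]
  push_cast; ring

/-- The functions `1_{y < x}` span all functions on a finite subset of the line. -/
theorem eq_zero_of_dual_below [Finite ι] (hinj : Function.Injective pos) {φ : (ι → ℂ) →ₗ[ℂ] ℂ}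
    (h : ∀ y, φ (below pos y) = 0) : φ = 0 := by
  classical
  have := Fintype.ofFinite ι
  refine LinearMap.pi_ext' fun i => LinearMap.ext_ring ?_
  show φ (Pi.single i 1) = 0
  have : ∀ᶠ y in 𝓝[<] (pos i), ∀ j, pos j < pos i → pos j < y :=
    eventually_all.mpr fun j => by
      by_cases hj : pos j < pos i
      · filter_upwards [nhdsWithin_le_nhds (Ioi_mem_nhds hj)] with y hy _ using hy
      · exact Eventually.of_forall fun y h => absurd h hj
  -- No point of the set lies in `[y, pos i)`, so the thresholds `y` and `pos i` differ only at `i`.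
  obtain ⟨y, hy, hy'⟩ := (this.and self_mem_nhdsWithin).exists
  have e : (Pi.single i 1 : ι → ℂ) = below pos y - below pos (pos i) := by
    funext j
    simp only [below, Pi.sub_apply, Pi.single_apply]
    have hyi : y < pos i := hy'
    rcases lt_trichotomy (pos j) (pos i) with hj | hj | hj
    · have := hy j hj
      rw [if_neg (fun e => by rw [e] at hj; exact lt_irrefl _ hj), if_neg this.not_gt,
        if_neg hj.not_gt, sub_zero]
    · rw [if_pos (hinj hj), hj, if_pos hyi, if_neg (lt_irrefl _), sub_zero]
    · rw [if_neg (fun e => by rw [e] at hj; exact lt_irrefl _ hj), if_pos (hyi.trans hj),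
        if_pos hj, sub_self]
  rw [e, map_sub, h, h, sub_self]

end StepFunctions

/-! ### The spectrum of the transfer operator. -/

namespace IsAffineTransfer

variable {ι : Type*} [Finite ι] {t c : ℝ} {pos : ι → ℝ} {next : ι → ι} {k : Fin 2 → ι}
  {A : Module.End ℂ (ι → ℂ)}

theorem norm_eigenvalue_le (h : IsAffineTransfer t c pos next k A) (ht : 1 < t) {μ : ℂ}
    (hμ : A.HasEigenvalue μ) : ‖μ‖ ≤ 1 := by
  by_contra! hlt
  obtain ⟨φ, hφ0, hφ⟩ := hμ.exists_dual
  obtain ⟨h1, -, h3⟩ := h.pushforward_dual ht hlt.le hφ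
  refine hφ0 (eq_zero_of_dual_below h.injective fun y => ?_)
  exact eq_zero_of_pushforward_eq_mul (by linarith) ((rightStep_below pos).map φ)
    (integrable_dual_below h1).1 hlt h3 y

theorem not_hasEigenvalue_one (h : IsAffineTransfer t c pos next k A) (ht : 1 < t) :
    ¬ A.HasEigenvalue 1 := by
  intro hμ
  obtain ⟨φ, hφ0, hφ⟩ := hμ.exists_dual
  obtain ⟨h1, h2, h3⟩ := h.pushforward_dual ht (by simp) hφ
  obtain ⟨hi, h4⟩ := integrable_dual_below (pos := pos) h1
  obtain ⟨B, hB⟩ := exists_bound pos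
  have hs : RightStep fun y => φ (below pos y) := (rightStep_below pos).map φ
  -- The sign argument needs real functions. For `μ = 1` the equation has real coefficients, so it
  -- passes to real and imaginary parts.
  have hlin : ∀ L : ℂ →L[ℝ] ℝ, ∀ y, L (φ (below pos y)) = 0 := by
    intro L
    refine eq_zero_of_pushforward_eq (c := c) ht (hs.map L) (L.integrable_comp hi) (B := B)
      (fun y hy => dual_below_support h1 hB fun e => hy (by rw [e, map_zero])) (fun y => ?_) ?_
    · have h5 : L (pushforward t c (fun y => φ (below pos y)) y) = t * L (φ (below pos y)) := by
        rw [h3 y, one_mul, ← Complex.real_smul, map_smul, smul_eq_mul]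
      rw [← h5]
      unfold pushforward
      rw [map_add]
      split_ifs <;> simp
    · rw [L.integral_comp_comm hi, h4, h2, map_zero]
  refine hφ0 (eq_zero_of_dual_below h.injective fun y => Complex.ext ?_ ?_)
  · exact hlin Complex.reCLM y
  · exact hlin Complex.imCLM y

theorem spectralRadius_le (h : IsAffineTransfer t c pos next k A) (ht : 1 < t) :
    spectralRadius ℂ A ≤ 1 := by
  refine iSup₂_le fun μ hμ => ?_
  have := h.norm_eigenvalue_le ht (Module.End.hasEigenvalue_iff_mem_spectrum.mpr hμ)
  exact_mod_cast this

end IsAffineTransfer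

/-! ### Holomorphic motions, lifts, and the transfer operator of the Lorenz family. -/

instance {ν : ℕ} (m : MarkedMap ν) : Finite m.gP := m.finite_post.to_subtype

theorem eventually_injective {ι : Type*} [Finite ι] {h : ℂ → ι → ℂ} {a : ℂ}
    (hc : ∀ x, ContinuousAt (fun l => h l x) a) (hi : Function.Injective (h a)) :
    ∀ᶠ l in 𝓝 a, Function.Injective (h l) := by
  have : ∀ᶠ l in 𝓝 a, ∀ x y, x ≠ y → h l x ≠ h l y :=
    eventually_all.mpr fun x => eventually_all.mpr fun y => by
      by_cases hxy : x = y
      · exact Eventually.of_forall fun _ h => absurd hxy h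
      · filter_upwards [((hc x).sub (hc y)).eventually_ne (sub_ne_zero.mpr (hi.ne hxy))]
          with l hl _ using sub_ne_zero.mp hl
  filter_upwards [this] with l hl x y hxy
  by_contra hne
  exact hl x y hne hxy

theorem exists_isHolomorphicMotion_ball {ν : ℕ} {m : MarkedMap ν} {h : ℂ → m.gP → ℂ} {a : ℂ}
    (hb : ∀ x, h a x = x)
    (hd : ∀ᶠ l in 𝓝 a, ∀ x, DifferentiableAt ℂ (fun l => h l x) l) :
    ∃ r > 0, ∀ r', 0 < r' → r' ≤ r → IsHolomorphicMotion m (Metric.ball a r') a h := by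
  have hi : ∀ᶠ l in 𝓝 a, Function.Injective (h l) :=
    eventually_injective (fun x => (hd.self_of_nhds x).continuousAt) fun x y hxy => by
      rw [hb, hb] at hxy; exact Subtype.ext hxy
  obtain ⟨r, hr, hball⟩ := Metric.eventually_nhds_iff_ball.mp (hi.and hd)
  refine ⟨r, hr, fun r' h0 hle => ⟨Metric.isOpen_ball, ?_, Metric.mem_ball_self h0, ?_, hb, ?_⟩⟩
  · exact (convex_ball a r').isConnected ⟨a, Metric.mem_ball_self h0⟩
  · exact fun l hl => (hball l (Metric.ball_subset_ball hle hl)).1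
  · exact fun x l hl =>
      ((hball l (Metric.ball_subset_ball hle hl)).2 x).differentiableWithinAt

section Lorenz

variable (t c : ℝ) (ht : 1 < t) (h : ∀ j, IsEventuallyPeriodic t c j)

/-- The points of the post-critical set on the real line. -/
def postPos (x : (lorenzMarkedMap t c ht h).gP) : ℝ := (x : ℂ).re

theorem ofReal_postPos (x : (lorenzMarkedMap t c ht h).gP) :
    (postPos t c ht h x : ℂ) = (x : ℂ) := by
  obtain ⟨j, n, hx, -⟩ := post_real t c x.2
  rw [postPos, hx, Complex.ofReal_re]

theorem postPos_injective : Function.Injective (postPos t c ht h) := fun x y hxy =>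
  Subtype.ext (by rw [← ofReal_postPos, ← ofReal_postPos, hxy])

theorem mem_range_c0_iff (x : (lorenzMarkedMap t c ht h).gP) :
    (x : ℂ) ∈ Set.range (lorenzMarkedMap t c ht h).c0 ↔ postPos t c ht h x = c := by
  rw [← ofReal_postPos]
  constructor
  · rintro ⟨_, hj⟩
    exact Complex.ofReal_injective hj.symm
  · intro hx
    exact ⟨0, by rw [hx]; rfl⟩

open Classical in
/-- The action of the Lorenz map on the post-critical set; the jump is treated as `c⁺`. -/
def postNext (x : (lorenzMarkedMap t c ht h).gP) : (lorenzMarkedMap t c ht h).gP :=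
  if hx : (x : ℂ) ∈ Set.range (lorenzMarkedMap t c ht h).c0
  then (lorenzMarkedMap t c ht h).val 1 else (lorenzMarkedMap t c ht h).next x hx

theorem postPos_val (j : Fin 2) :
    postPos t c ht h ((lorenzMarkedMap t c ht h).val j) = criticalValue t c j :=
  Complex.ofReal_re _

theorem lorenz_self : lorenz t c c = criticalValue t c 1 := by
  simp [lorenz, criticalValue]

theorem postPos_next (x : (lorenzMarkedMap t c ht h).gP) :
    postPos t c ht h (postNext t c ht h x) = lorenz t c (postPos t c ht h x) := by
  unfold postNext
  split_ifs with hx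
  · rw [postPos_val, (mem_range_c0_iff t c ht h x).mp hx, lorenz_self]
  · show (branches c (cval t c) x).re = _
    rw [← ofReal_postPos, branches_ofReal, Complex.ofReal_re]

/-- The transfer operator of the Lorenz family. -/
def lorenzTransfer : Module.End ℂ ((lorenzMarkedMap t c ht h).gP → ℂ) where
  toFun v x := (v (postNext t c ht h x) -
    (v ((lorenzMarkedMap t c ht h).val 0) - v ((lorenzMarkedMap t c ht h).val 1)) / 2 *
      ((postPos t c ht h x : ℂ) + side c (postPos t c ht h x))) / t
  map_add' v w := by
    funext x
    simp only [Pi.add_apply]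
    ring
  map_smul' a v := by
    funext x
    simp only [Pi.smul_apply, smul_eq_mul, RingHom.id_apply]
    ring

theorem isAffineTransfer : IsAffineTransfer t c (postPos t c ht h) (postNext t c ht h)
    (lorenzMarkedMap t c ht h).val (lorenzTransfer t c ht h) where
  pos_next := postPos_next t c ht h
  pos_k := postPos_val t c ht h
  injective := postPos_injective t c ht h
  apply _ _ := rfl

variable {t c ht h}

/-- The equations of a lift, on each branch. -/
theorem isLift_iff {a : ℂ} {hm h' : ℂ → (lorenzMarkedMap t c ht h).gP → ℂ}
    (hb : ∀ x, hm a x = x) (hb' : ∀ x, h' a x = x)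
    (hc : ∀ x, ContinuousAt (fun l => hm l x) a) (hc' : ∀ x, ContinuousAt (fun l => h' l x) a) :
    IsLift (lorenzDeformation t c ht h) a hm h' ↔
      ∀ᶠ l in 𝓝 a, ∀ x,
        slope (fun k => hm l ((lorenzMarkedMap t c ht h).val k)) * h' l x +
          side c (postPos t c ht h x) *
            (slope (fun k => hm l ((lorenzMarkedMap t c ht h).val k)) - 1) =
          hm l (postNext t c ht h x) := by
  have hw : ContinuousAt (fun l => slope (fun k => hm l ((lorenzMarkedMap t c ht h).val k))) a :=
    differentiable_slope.continuous.continuousAt.comp (continuousAt_pi.mpr fun k => hc _)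
  have h1 : ∀ᶠ l in 𝓝 a, slope (fun k => hm l ((lorenzMarkedMap t c ht h).val k)) ≠ 0 := by
    refine hw.eventually_ne ?_
    simp only [hb]
    show slope (cval t c) ≠ 0
    rw [slope_cval]
    exact_mod_cast (by linarith : t ≠ 0)
  -- Near the base parameter a point off the jump stays on its side of `c`, so its branch does not
  -- change.
  have h2 : ∀ᶠ l in 𝓝 a, ∀ x, postPos t c ht h x ≠ c →
      ((h' l x).re < c ↔ postPos t c ht h x < c) := by
    refine eventually_all.mpr fun x => ?_
    have hre : ContinuousAt (fun l => (h' l x).re) a := Complex.continuous_re.continuousAt.comp (hc' x)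
    have hval : (h' a x).re = postPos t c ht h x := by rw [hb']; rfl
    rcases lt_trichotomy (postPos t c ht h x) c with hx | hx | hx
    · filter_upwards [hre.eventually_lt_const (hval.trans_lt hx)] with l hl _
      exact ⟨fun _ => hx, fun _ => hl⟩
    · exact Eventually.of_forall fun l hne => absurd hx hne
    · filter_upwards [hre.eventually_const_lt (hx.trans_eq hval.symm)] with l hl _
      exact ⟨fun h3 => absurd h3 hl.not_gt, fun h3 => absurd h3 hx.not_gt⟩
  refine eventually_congr ?_
  filter_upwards [h1, h2] with l h1 h2
  set w : Fin 2 → ℂ := fun k => hm l ((lorenzMarkedMap t c ht h).val k) with hwdef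
  -- The jump `p(w)` solves `t(w) p - (t(w) - 1) = w₂`, so the lift condition at `c` is the
  -- right-branch equation with image `c₁,₂`.
  have key1 : ∀ x : (lorenzMarkedMap t c ht h).gP, postPos t c ht h x = c →
      (h' l x = jump w ↔ slope w * h' l x + side c (postPos t c ht h x) * (slope w - 1) =
        hm l (postNext t c ht h x)) := by
    intro x hx
    have e1 : hm l (postNext t c ht h x) = w 1 := by
      rw [postNext, dif_pos ((mem_range_c0_iff t c ht h x).mpr hx)]
    have e2 : slope w = 1 + (w 0 - w 1) / 2 := rfl
    rw [e1, hx, side, if_neg (lt_irrefl c), jump, eq_div_iff (mul_ne_zero two_ne_zero h1)]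
    push_cast
    constructor <;> intro e3
    · linear_combination e3 / 2 - e2
    · linear_combination 2 * e3 + 2 * e2
  have key2 : ∀ x : (lorenzMarkedMap t c ht h).gP, postPos t c ht h x ≠ c →
      branches c w (h' l x) =
        slope w * h' l x + side c (postPos t c ht h x) * (slope w - 1) := by
    intro x hx
    unfold branches side
    by_cases hlt : postPos t c ht h x < c
    · rw [if_pos ((h2 x hx).mpr hlt), if_pos hlt]; push_cast; ring
    · rw [if_neg (fun e => hlt ((h2 x hx).mp e)), if_neg hlt]; push_cast; ring
  constructor
  · rintro ⟨h3, h4⟩ x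
    by_cases hx : postPos t c ht h x = c
    · exact (key1 x hx).mp (h3 0 x (by rw [← ofReal_postPos, hx]; rfl))
    · have hx' := mt (mem_range_c0_iff t c ht h x).mp hx
      rw [← key2 x hx, postNext, dif_neg hx']
      exact h4 x hx'
  · intro h3
    refine ⟨fun j x hx => ?_, fun x hx => ?_⟩
    · exact (key1 x ((mem_range_c0_iff t c ht h x).mp ⟨j, hx.symm⟩)).mpr (h3 x)
    · have h4 := h3 x
      rw [← key2 x (mt (mem_range_c0_iff t c ht h x).mpr hx), postNext, dif_neg hx] at h4
      exact h4

theorem hasDerivAt_slope {w : ℂ → Fin 2 → ℂ} {v : Fin 2 → ℂ} {a : ℂ}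
    (hw : ∀ k, HasDerivAt (fun l => w l k) (v k) a) :
    HasDerivAt (fun l => slope (w l)) ((v 0 - v 1) / 2) a :=
  (((hw 0).sub (hw 1)).div_const 2).const_add 1

variable (t c ht h)

theorem isTransferOperator_lorenzTransfer :
    IsTransferOperator (lorenzDeformation t c ht h) (lorenzTransfer t c ht h) := by
  intro a Λ Λ₀ hm h' _ hΛ hΛ₀ hlift
  have hd : ∀ x, DifferentiableAt ℂ (fun l => hm l x) a := fun x =>
    (hΛ.holomorphic x).differentiableAt (hΛ.isOpen.mem_nhds hΛ.base_mem)
  have hd' : ∀ x, DifferentiableAt ℂ (fun l => h' l x) a := fun x =>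
    (hΛ₀.holomorphic x).differentiableAt (hΛ₀.isOpen.mem_nhds hΛ₀.base_mem)
  have heq := (isLift_iff hΛ.base hΛ₀.base (fun x => (hd x).continuousAt)
    (fun x => (hd' x).continuousAt)).mp hlift
  funext x
  have hs := hasDerivAt_slope (w := fun l k => hm l ((lorenzMarkedMap t c ht h).val k))
    fun k => (hd _).hasDerivAt
  have h1 := (hs.mul (hd' x).hasDerivAt).add
    ((hs.sub_const 1).const_mul (side c (postPos t c ht h x) : ℂ))
  have h2 := h1.unique ((hd (postNext t c ht h x)).hasDerivAt.congr_of_eventuallyEq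
    (heq.mono fun l hl => hl x))
  have e : slope (fun k => hm a ((lorenzMarkedMap t c ht h).val k)) = t := by
    simp only [hΛ.base]
    exact slope_cval t c
  rw [e, hΛ₀.base, ← ofReal_postPos] at h2
  have ht' : (t : ℂ) ≠ 0 := by exact_mod_cast (by linarith : t ≠ 0)
  rw [(isAffineTransfer t c ht h).apply, div_eq_iff ht', ← h2]
  ring

/-- Every vector is the velocity of a holomorphic motion which has a lift. -/
theorem exists_motion_lift (v : (lorenzMarkedMap t c ht h).gP → ℂ) :
    ∃ (Λ : Set ℂ) (hm h' : ℂ → (lorenzMarkedMap t c ht h).gP → ℂ),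
      IsHolomorphicMotion _ Λ 0 hm ∧ IsHolomorphicMotion _ Λ 0 h' ∧
      IsLift (lorenzDeformation t c ht h) 0 hm h' ∧ (fun x => deriv (fun l => hm l x) 0) = v := by
  have ht' : (t : ℂ) ≠ 0 := by exact_mod_cast (by linarith : t ≠ 0)
  set hm : ℂ → (lorenzMarkedMap t c ht h).gP → ℂ := fun l x => x + l * v x with hmdef
  set s : ℂ → ℂ := fun l => slope fun k => hm l ((lorenzMarkedMap t c ht h).val k) with hs
  -- The lift equations are affine in `h'` with leading coefficient `s l`, so they can be solved
  -- explicitly.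
  set h' : ℂ → (lorenzMarkedMap t c ht h).gP → ℂ := fun l x =>
    (hm l (postNext t c ht h x) - side c (postPos t c ht h x) * (s l - 1)) / s l with hdef'
  have hd : ∀ x, Differentiable ℂ fun l => hm l x := fun x => by simp only [hmdef]; fun_prop
  have hsd : Differentiable ℂ s := differentiable_slope.comp (differentiable_pi.mpr fun k => hd _)
  have hb : ∀ x, hm 0 x = x := fun x => by simp [hmdef]
  have hs0 : s 0 = t := by
    simp only [hs, hb]
    exact slope_cval t c
  have hne : ∀ᶠ l in 𝓝 0, s l ≠ 0 :=
    hsd.continuous.continuousAt.eventually_ne (by rw [hs0]; exact ht')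
  have hb' : ∀ x, h' 0 x = x := fun x => by
    simp only [hdef', hb, hs0]
    rw [← ofReal_postPos, postPos_next, lorenz_eq, ← ofReal_postPos t c ht h x,
      div_eq_iff ht']
    push_cast
    ring
  have hd' : ∀ᶠ l in 𝓝 0, ∀ x, DifferentiableAt ℂ (fun l => h' l x) l := by
    filter_upwards [hne] with l hl x
    exact ((hd _ l).sub (((hsd l).sub_const 1).const_mul _)).div (hsd l) hl
  obtain ⟨r₁, hr₁, h1⟩ := exists_isHolomorphicMotion_ball hb
    (Eventually.of_forall fun l x => hd x l)
  obtain ⟨r₂, hr₂, h2⟩ := exists_isHolomorphicMotion_ball hb' hd'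
  refine ⟨Metric.ball 0 (min r₁ r₂), hm, h', h1 _ (lt_min hr₁ hr₂) (min_le_left _ _),
    h2 _ (lt_min hr₁ hr₂) (min_le_right _ _), ?_, ?_⟩
  · refine (isLift_iff hb hb' (fun x => (hd x).continuous.continuousAt)
      (fun x => (hd'.self_of_nhds x).continuousAt)).mpr ?_
    filter_upwards [hne] with l hl x
    show s l * h' l x + side c (postPos t c ht h x) * (s l - 1) = _
    simp only [hdef']
    rw [mul_div_cancel₀ _ hl]
    ring
  · funext x
    have : HasDerivAt (fun l => hm l x) (1 * v x) 0 :=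
      ((hasDerivAt_id (0 : ℂ)).mul_const (v x)).const_add _
    rw [this.deriv, one_mul]

theorem isTransferOperator_unique {A B : Module.End ℂ ((lorenzMarkedMap t c ht h).gP → ℂ)}
    (hA : IsTransferOperator (lorenzDeformation t c ht h) A)
    (hB : IsTransferOperator (lorenzDeformation t c ht h) B) : A = B := by
  refine LinearMap.ext fun v => ?_
  obtain ⟨Λ, hm, h', h1, h2, h3, rfl⟩ := exists_motion_lift t c ht h v
  rw [hA 0 Λ Λ hm h' subset_rfl h1 h2 h3, hB 0 Λ Λ hm h' subset_rfl h1 h2 h3]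

end Lorenz

/-! ### Existence of critical relations. -/

/-- The relation found at the first repetition in an orbit is minimal among all relations. -/
theorem le_of_first_repetition {α : Type*} {g : α → α} {x : α} {l q : ℕ} (hlq : l < q)
    (he : g^[q] x = g^[l] x) (hmin : ∀ l' q', l' < q' → g^[q'] x = g^[l'] x → q ≤ q') :
    ∀ q' l', l' < q' → g^[q'] x = g^[l'] x → l ≤ l' := by
  intro q'
  induction q' using Nat.strong_induction_on with
  | _ q' ih =>
    intro l' hl' he'
    by_contra! hlt
    have hq := hmin l' q' hl' he'
    rcases hq.eq_or_lt with rfl | hq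
    · have := hmin l' l hlt (by rw [← he, he'])
      omega
    -- Lowering `q'` by the period `q - l` gives an earlier repetition with the same `l'`.
    · have e : g^[q' - q + l] x = g^[q'] x := by
        rw [Function.iterate_add_apply, ← he, ← Function.iterate_add_apply]
        congr 2; omega
      have := ih (q' - q + l) (by omega) l' (by omega) (by rw [e, he'])
      omega

theorem MarkedMap.exists_satisfies {ν : ℕ} (m : MarkedMap ν) (j : Fin ν) :
    ∃ r, m.Satisfies j r := by
  classical
  by_cases hit : ∃ n, m.g^[n] (m.c1 j) ∈ Set.range m.c0
  · obtain ⟨μ, hμ⟩ := Nat.find_spec hit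
    -- Relations count time from the marked point, one step before its value; hence the `+ 1`.
    refine ⟨.periodic (Nat.find hit + 1) μ, by omega, hμ.symm, fun k hk hkq => ?_⟩
    exact Nat.find_min hit (by omega)
  · push Not at hit
    have hpost : ∀ n, PostOrbit m.c0 m.c1 m.g (m.g^[n] (m.c1 j)) := by
      intro n
      induction n with
      | zero => exact .value j
      | succ n ih =>
        rw [Function.iterate_succ_apply']
        exact .step _ ih (hit n)
    have hrep : ∃ q, ∃ l < q, m.g^[q] (m.c1 j) = m.g^[l] (m.c1 j) := by
      obtain ⟨a, b, hab, he⟩ := m.finite_post.exists_lt_map_eq_of_forall_mem hpost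
      exact ⟨b, a, hab, he.symm⟩
    obtain ⟨l, hl, he⟩ := Nat.find_spec hrep
    have hmin : ∀ l' q', l' < q' → m.g^[q'] (m.c1 j) = m.g^[l'] (m.c1 j) →
        Nat.find hrep ≤ q' := fun l' q' h1 h2 => Nat.find_min' hrep ⟨l', h1, h2⟩
    refine ⟨.preperiodic (l + 1) (Nat.find hrep + 1), by omega, by omega, he,
      fun k _ _ => hit _, fun l' q' h1 h2 h3 => ?_⟩
    have h4 := hmin (l' - 1) (q' - 1) (by omega) h3
    have h5 := le_of_first_repetition hl he hmin (q' - 1) (l' - 1) (by omega) h3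
    omega

/-! ### The bounded solution and the inequality `τ(Φ_t) < 1`. -/

namespace IsAffineTransfer

variable {ι : Type*} {t c : ℝ} {pos : ι → ℝ} {next : ι → ι} {k : Fin 2 → ι}
  {A : Module.End ℂ (ι → ℂ)}

/-- The bounded solution `Φ` of `Φ (f x) = s Φ(x) + (x + σ(x))`. -/
def boundedSolution (c : ℝ) (pos : ι → ℝ) (next : ι → ι) (s : ℝ) (i : ι) : ℝ :=
  -∑' n : ℕ, (pos (next^[n] i) + side c (pos (next^[n] i))) / s ^ (n + 1)

theorem exists_coeff_bound [Finite ι] (c : ℝ) (pos : ι → ℝ) :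
    ∃ C, 0 < C ∧ ∀ i, |pos i + side c (pos i)| ≤ C := by
  obtain ⟨B, hB⟩ := exists_bound fun i => pos i + side c (pos i)
  exact ⟨|B| + 1, by positivity, fun i => (hB i).le.trans (by linarith [le_abs_self B])⟩

theorem norm_term_le {C s r : ℝ} {pos : ι → ℝ} (hr : 1 < r) (hrs : r ≤ s)
    (hC : ∀ i, |pos i + side c (pos i)| ≤ C) (i : ι) (n : ℕ) :
    ‖(pos (next^[n] i) + side c (pos (next^[n] i))) / s ^ (n + 1)‖ ≤ C / r ^ (n + 1) := by
  have hr0 : 0 < r := by linarith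
  have hs0 : 0 < s := by linarith
  rw [norm_div, Real.norm_eq_abs, Real.norm_of_nonneg (pow_nonneg hs0.le _)]
  have := (abs_nonneg _).trans (hC i)
  exact div_le_div₀ this (hC _) (by positivity) (by gcongr)

theorem hasSum_bound {r : ℝ} (hr : 1 < r) (C : ℝ) :
    HasSum (fun n : ℕ => C / r ^ (n + 1)) (C / (r - 1)) := by
  have hr0 : 0 < r := by linarith
  have h1 := (hasSum_geometric_of_lt_one (inv_nonneg.mpr hr0.le)
    (inv_lt_one_of_one_lt₀ hr)).mul_left (C / r)
  have e : C / r * (1 - r⁻¹)⁻¹ = C / (r - 1) := by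
    have : r - 1 ≠ 0 := by linarith
    have h2 : (1 - r⁻¹) = (r - 1) / r := by field_simp
    rw [h2, inv_div]
    field_simp
  rw [e] at h1
  have e' : (fun n : ℕ => C / r ^ (n + 1)) = fun n => C / r * r⁻¹ ^ n := by
    funext n
    rw [inv_pow, pow_succ]
    field_simp
  rw [e']
  exact h1

theorem abs_boundedSolution_le {C s : ℝ} (hs : 1 < s) (hC : ∀ i, |pos i + side c (pos i)| ≤ C)
    (i : ι) : |boundedSolution c pos next s i| ≤ C / (s - 1) := by
  rw [boundedSolution, abs_neg]
  exact tsum_of_norm_bounded (hasSum_bound hs C) fun n => norm_term_le hs le_rfl hC i n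

variable [Finite ι]

theorem summable_term (c : ℝ) (pos : ι → ℝ) (next : ι → ι) {s : ℝ} (hs : 1 < s) (i : ι) :
    Summable fun n : ℕ => (pos (next^[n] i) + side c (pos (next^[n] i))) / s ^ (n + 1) := by
  obtain ⟨C, -, hC⟩ := exists_coeff_bound c pos
  exact Summable.of_norm_bounded (hasSum_bound hs C).summable fun n =>
    norm_term_le hs le_rfl hC i n

theorem boundedSolution_next (c : ℝ) (pos : ι → ℝ) (next : ι → ι) {s : ℝ} (hs : 1 < s) (i : ι) :
    boundedSolution c pos next s (next i) =
      s * boundedSolution c pos next s i + (pos i + side c (pos i)) := by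
  have hs0 : s ≠ 0 := by linarith
  have h1 := (summable_term c pos next hs i).tsum_eq_zero_add
  have h2 : ∑' n : ℕ, (pos (next^[n] (next i)) + side c (pos (next^[n] (next i)))) / s ^ (n + 1) =
      s * ∑' n : ℕ, (pos (next^[n + 1] i) + side c (pos (next^[n + 1] i))) / s ^ (n + 1 + 1) := by
    rw [← tsum_mul_left]
    refine tsum_congr fun n => ?_
    rw [Function.iterate_succ_apply, pow_succ s (n + 1)]
    field_simp
  unfold boundedSolution
  rw [h2, h1]
  simp only [Function.iterate_zero_apply, zero_add, pow_one]
  field_simp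
  ring

theorem continuousOn_boundedSolution (c : ℝ) (pos : ι → ℝ) (next : ι → ι) {r : ℝ} (hr : 1 < r)
    (i : ι) : ContinuousOn (fun s => boundedSolution c pos next s i) (Set.Ici r) := by
  obtain ⟨C, -, hC⟩ := exists_coeff_bound c pos
  refine ContinuousOn.neg (continuousOn_tsum (fun n => ?_) (hasSum_bound hr C).summable
    fun n s hs => norm_term_le hr hs hC i n)
  refine continuousOn_const.div (by fun_prop) fun s hs => pow_ne_zero _ ?_
  have : r ≤ s := hs
  linarith

/-- A velocity of slope `1` carried by the bounded solution is an eigenvector. -/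
theorem boundedSolution_ne (h : IsAffineTransfer t c pos next k A) (ht : 1 < t) {s : ℝ}
    (hs : t ≤ s) :
    (boundedSolution c pos next s (k 0) - boundedSolution c pos next s (k 1)) / 2 ≠ 1 := by
  intro he
  have ht0 : 0 < t := by linarith
  have ht' : (t : ℂ) ≠ 0 := by exact_mod_cast ht0.ne'
  set v : ι → ℂ := fun i => (boundedSolution c pos next s i : ℂ) with hv
  have hv0 : v ≠ 0 := fun h0 => by
    have h1 : ∀ i, boundedSolution c pos next s i = 0 := fun i => by
      have := congrFun h0 i
      simpa [hv] using this
    rw [h1, h1] at he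
    norm_num at he
  -- With `τ(v) = 1` the forcing term `x + σ(x)` in the recurrence of `Φ_s` is exactly what `A`
  -- subtracts, leaving `s v / t`.
  have hA : A v = ((s / t : ℝ) : ℂ) • v := by
    funext i
    have he' : (v (k 0) - v (k 1)) / 2 = 1 := by
      simp only [hv]
      exact_mod_cast he
    rw [h.apply, he', Pi.smul_apply, smul_eq_mul]
    simp only [hv]
    rw [boundedSolution_next c pos next (ht.trans_le hs)]
    push_cast
    field_simp
    ring
  have hE : A.HasEigenvalue ((s / t : ℝ) : ℂ) :=
    Module.End.hasEigenvalue_of_hasEigenvector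
      ⟨Module.End.mem_eigenspace_iff.mpr hA, hv0⟩
  have hle := h.norm_eigenvalue_le ht hE
  rw [Complex.norm_real, Real.norm_of_nonneg (div_nonneg (by linarith) ht0.le), div_le_one ht0] at hle
  have hst : s = t := le_antisymm hle hs
  rw [hst, div_self ht0.ne', Complex.ofReal_one] at hE
  exact h.not_hasEigenvalue_one ht hE

theorem boundedSolution_lt (h : IsAffineTransfer t c pos next k A) (ht : 1 < t) :
    (boundedSolution c pos next t (k 0) - boundedSolution c pos next t (k 1)) / 2 < 1 := by
  obtain ⟨C, hC0, hC⟩ := exists_coeff_bound c pos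
  set F : ℝ → ℝ := fun s =>
    (boundedSolution c pos next s (k 0) - boundedSolution c pos next s (k 1)) / 2 with hF
  have hcont : ContinuousOn F (Set.Ici t) :=
    ((continuousOn_boundedSolution c pos next ht _).sub
      (continuousOn_boundedSolution c pos next ht _)).div_const 2
  by_contra hle
  have hle' : 1 ≤ F t := not_lt.mp hle
  -- The bound `|Φ_s| ≤ C / (s - 1)` gives `F s ≤ C / (s - 1)`, and `s = t + 2 * C` makes this less
  -- than `1`.
  have hlarge : F (t + 2 * C) < 1 := by
    have hs : 1 < t + 2 * C := by linarith
    have h0 := abs_le.mp (abs_boundedSolution_le (next := next) hs hC (k 0))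
    have h1 := abs_le.mp (abs_boundedSolution_le (next := next) hs hC (k 1))
    have h2 : C / (t + 2 * C - 1) < 1 := by rw [div_lt_one (by linarith)]; linarith
    simp only [hF]
    linarith [h0.2, h1.1]
  obtain ⟨s, hs, hs1⟩ := intermediate_value_Icc' (by linarith : t ≤ t + 2 * C)
    (hcont.mono Set.Icc_subset_Ici_self) ⟨hlarge.le, hle'⟩
  exact h.boundedSolution_ne ht hs.1 hs1

end IsAffineTransfer

/-! ### Derivatives of the branches and of the jump. -/

theorem hasDerivAt_branches_iterate {c : ℝ} {w : Fin 2 → ℂ} {z : ℂ} {n : ℕ}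
    (hn : ∀ k < n, ((branches c w)^[k] z).re ≠ c) :
    HasDerivAt (branches c w)^[n] (slope w ^ n) z := by
  induction n with
  | zero => simpa using hasDerivAt_id z
  | succ n ih =>
    have h1 := (branches_hasDerivAt c w _ (hn n (Nat.lt_succ_self n))).comp z
      (ih fun k hk => hn k (by omega))
    rw [Function.iterate_succ', pow_succ']
    exact h1

/-- The derivative of the slope. -/
def slopeDeriv : (Fin 2 → ℂ) →L[ℂ] ℂ :=
  (1 / 2 : ℂ) • (ContinuousLinearMap.proj (R := ℂ) (φ := fun _ : Fin 2 => ℂ) 0 -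
    ContinuousLinearMap.proj (R := ℂ) (φ := fun _ : Fin 2 => ℂ) 1)

theorem slopeDeriv_apply (v : Fin 2 → ℂ) : slopeDeriv v = (v 0 - v 1) / 2 := by
  simp [slopeDeriv]
  ring

theorem hasFDerivAt_slope (w : Fin 2 → ℂ) : HasFDerivAt slope slopeDeriv w := by
  have h0 : HasFDerivAt (fun w : Fin 2 → ℂ => slopeDeriv w + 1) slopeDeriv w :=
    slopeDeriv.hasFDerivAt.add_const 1
  refine h0.congr_of_eventuallyEq (Eventually.of_forall fun w => ?_)
  show slope w = slopeDeriv w + 1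
  rw [slopeDeriv_apply, slope]
  ring

theorem hasFDerivAt_branches_comp {c : ℝ} {y : (Fin 2 → ℂ) → ℂ} {L : (Fin 2 → ℂ) →L[ℂ] ℂ}
    {w₀ : Fin 2 → ℂ} (hy : HasFDerivAt y L w₀) (hne : (y w₀).re ≠ c) :
    HasFDerivAt (fun w => branches c w (y w))
      (slope w₀ • L + (y w₀ + side c (y w₀).re) • slopeDeriv) w₀ := by
  have hs := hasFDerivAt_slope w₀
  have h1 := (hs.mul hy).add ((hs.sub_const 1).const_mul (side c (y w₀).re : ℂ))
  refine (h1.congr_fderiv (g' := slope w₀ • L + (y w₀ + side c (y w₀).re) • slopeDeriv)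
    (ContinuousLinearMap.ext fun v => ?_)).congr_of_eventuallyEq ?_
  · simp only [smul_apply, add_apply, smul_eq_mul]
    ring
  have hre : ContinuousAt (fun w => (y w).re) w₀ :=
    Complex.continuous_re.continuousAt.comp hy.continuousAt
  rcases lt_or_gt_of_ne hne with hlt | hlt
  · filter_upwards [hre.eventually_lt_const hlt] with w hw
    simp only [branches, side, if_pos hlt, if_pos hw, Pi.add_apply, Pi.mul_apply]
    push_cast; ring
  · filter_upwards [hre.eventually_const_lt hlt] with w hw
    simp only [branches, side, if_neg hlt.not_gt, if_neg hw.not_gt, Pi.add_apply, Pi.mul_apply]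
    push_cast; ring

/-- Differentiating the right-branch equation for `p(w)` gives this form, which matches the
recurrence of `Φ` at `c⁺`. -/
theorem hasFDerivAt_jump {w₀ : Fin 2 → ℂ} (hw : slope w₀ ≠ 0) :
    HasFDerivAt jump ((slope w₀)⁻¹ •
      (ContinuousLinearMap.proj (R := ℂ) (φ := fun _ : Fin 2 => ℂ) 1 +
        (1 - jump w₀) • slopeDeriv)) w₀ := by
  have hs := hasFDerivAt_slope w₀
  have hp : HasFDerivAt (fun w : Fin 2 → ℂ => w 1)
      (ContinuousLinearMap.proj (R := ℂ) (φ := fun _ : Fin 2 => ℂ) 1) w₀ :=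
    (ContinuousLinearMap.proj (R := ℂ) (φ := fun _ : Fin 2 => ℂ) 1).hasFDerivAt
  have hinv : HasFDerivAt (fun w => (slope w)⁻¹) ((-(slope w₀ ^ 2)⁻¹) • slopeDeriv) w₀ :=
    (hasDerivAt_inv hw).comp_hasFDerivAt w₀ hs
  have e : ∀ w : Fin 2 → ℂ, w 0 + w 1 = 2 * (w 1 + (slope w - 1)) := fun w => by
    rw [slope]; ring
  have h1 := (hp.add (hs.sub_const 1)).mul hinv
  have hj : ∀ w : Fin 2 → ℂ, jump w = (w 1 + (slope w - 1)) * (slope w)⁻¹ := fun w => by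
    rw [jump, e, mul_div_mul_left _ _ two_ne_zero, div_eq_mul_inv]
  refine HasFDerivAt.congr_of_eventuallyEq ?_ (Eventually.of_forall hj)
  refine h1.congr_fderiv (ContinuousLinearMap.ext fun v => ?_)
  simp only [smul_apply, add_apply, smul_eq_mul, Pi.add_apply, hj]
  field_simp
  ring

/-! ### The derivative of the critical relations and its determinant. -/

section Lorenz

variable (t c : ℝ) (ht : 1 < t) (h : ∀ j, IsEventuallyPeriodic t c j)

/-- The bounded solution of the velocity equation on the post-critical set. -/
def postSolution (x : (lorenzMarkedMap t c ht h).gP) : ℝ :=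
  IsAffineTransfer.boundedSolution c (postPos t c ht h) (postNext t c ht h) t x

theorem postSolution_next (x : (lorenzMarkedMap t c ht h).gP) :
    postSolution t c ht h (postNext t c ht h x) = t * postSolution t c ht h x +
      (postPos t c ht h x + side c (postPos t c ht h x)) :=
  IsAffineTransfer.boundedSolution_next c _ _ ht x

/-- The deviation of the velocity of a critical value from the bounded solution. -/
def deviation (j : Fin 2) : (Fin 2 → ℂ) →L[ℂ] ℂ :=
  ContinuousLinearMap.proj (R := ℂ) (φ := fun _ : Fin 2 => ℂ) j -
    (postSolution t c ht h ((lorenzMarkedMap t c ht h).val j) : ℂ) • slopeDeriv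

/-- The iterate of the `j`-th critical value as a post-critical point. -/
def orbitPoint (j : Fin 2) (n : ℕ) : (lorenzMarkedMap t c ht h).gP :=
  (postNext t c ht h)^[n] ((lorenzMarkedMap t c ht h).val j)

variable {t c ht h}

theorem coe_orbitPoint {j : Fin 2} {n : ℕ}
    (hn : ∀ k < n, (lorenzMarkedMap t c ht h).g^[k] ((lorenzMarkedMap t c ht h).c1 j) ∉
      Set.range (lorenzMarkedMap t c ht h).c0) :
    (orbitPoint t c ht h j n : ℂ) =
      (lorenzMarkedMap t c ht h).g^[n] ((lorenzMarkedMap t c ht h).c1 j) := by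
  induction n with
  | zero => rfl
  | succ n ih =>
    have ih' := ih fun k hk => hn k (by omega)
    have hx : (orbitPoint t c ht h j n : ℂ) ∉ Set.range (lorenzMarkedMap t c ht h).c0 := by
      rw [ih']; exact hn n (Nat.lt_succ_self n)
    rw [orbitPoint, Function.iterate_succ_apply', Function.iterate_succ_apply', ← ih', postNext]
    exact congrArg Subtype.val (dif_neg hx)

theorem iterate_re_ne {j : Fin 2} {n : ℕ}
    (hn : ∀ k ≤ n, (lorenzMarkedMap t c ht h).g^[k] ((lorenzMarkedMap t c ht h).c1 j) ∉
      Set.range (lorenzMarkedMap t c ht h).c0) :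
    ((branches c (cval t c))^[n] (cval t c j)).re ≠ c := by
  have e := coe_orbitPoint (j := j) (n := n) fun k hk => hn k hk.le
  have h1 := hn n le_rfl
  rw [← e, mem_range_c0_iff, postPos, e] at h1
  exact h1

/-- Derivatives along the orbit obey `D ↦ t D + (x + σ(x)) dt`. A particular solution is `Φ dt`; the
deviation is the initial difference, which the homogeneous equation multiplies by `t` at each step.
-/
theorem hasFDerivAt_iterate {j : Fin 2} {n : ℕ}
    (hn : ∀ k < n, (lorenzMarkedMap t c ht h).g^[k] ((lorenzMarkedMap t c ht h).c1 j) ∉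
      Set.range (lorenzMarkedMap t c ht h).c0) :
    HasFDerivAt (fun w => (branches c w)^[n] (w j))
      ((t : ℂ) ^ n • deviation t c ht h j +
        (postSolution t c ht h (orbitPoint t c ht h j n) : ℂ) • slopeDeriv) (cval t c) := by
  induction n with
  | zero =>
    have e : (t : ℂ) ^ 0 • deviation t c ht h j +
        (postSolution t c ht h (orbitPoint t c ht h j 0) : ℂ) • slopeDeriv =
        ContinuousLinearMap.proj (R := ℂ) (φ := fun _ : Fin 2 => ℂ) j := by
      rw [pow_zero, one_smul, deviation, orbitPoint, Function.iterate_zero_apply, sub_add_cancel]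
    rw [e]
    exact (ContinuousLinearMap.proj (R := ℂ) (φ := fun _ : Fin 2 => ℂ) j).hasFDerivAt
  | succ n ih =>
    have hlt : ∀ k < n, (lorenzMarkedMap t c ht h).g^[k] ((lorenzMarkedMap t c ht h).c1 j) ∉
      Set.range (lorenzMarkedMap t c ht h).c0 := fun k hk => hn k (by omega)
    have h1 := hasFDerivAt_branches_comp (ih hlt)
      (iterate_re_ne fun k hk => hn k (Nat.lt_succ_of_le hk))
    have e1 : (branches c (cval t c))^[n] (cval t c j) =
        postPos t c ht h (orbitPoint t c ht h j n) := by
      rw [ofReal_postPos, coe_orbitPoint hlt]; rfl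
    have e2 := postSolution_next t c ht h (orbitPoint t c ht h j n)
    have e3 : postNext t c ht h (orbitPoint t c ht h j n) = orbitPoint t c ht h j (n + 1) :=
      (Function.iterate_succ_apply' _ _ _).symm
    rw [e3] at e2
    simp only [Function.iterate_succ_apply']
    refine h1.congr_fderiv ?_
    rw [e1, e2, slope_cval, Complex.ofReal_re]
    refine ContinuousLinearMap.ext fun v => ?_
    simp only [smul_apply, add_apply, smul_eq_mul]
    push_cast
    ring

/-- The derivative of a critical relation in terms of the deviations. -/
theorem exists_hasFDerivAt_R {rel : Fin 2 → Relation 2} {j : Fin 2}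
    (hj : (lorenzMarkedMap t c ht h).Satisfies j (rel j)) :
    ∃ α β : ℝ, 0 < α ∧ β < α ∧
      HasFDerivAt (fun w => (lorenzDeformation t c ht h).R rel w j)
        ((α : ℂ) • deviation t c ht h j - (β : ℂ) • deviation t c ht h 1) (cval t c) := by
  have ht0 : 0 < t := by linarith
  have ht' : (t : ℂ) ≠ 0 := by exact_mod_cast ht0.ne'
  cases hr : rel j with
  | periodic q μ =>
    rw [hr] at hj
    obtain ⟨hq, he, hn⟩ := hj
    have hlt : ∀ k < q - 1, (lorenzMarkedMap t c ht h).g^[k] ((lorenzMarkedMap t c ht h).c1 j) ∉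
        Set.range (lorenzMarkedMap t c ht h).c0 := fun k hk => hn (k + 1) (by omega) (by omega)
    have hpos : postPos t c ht h (orbitPoint t c ht h j (q - 1)) = c := by
      rw [← mem_range_c0_iff, coe_orbitPoint hlt, he]
      exact ⟨μ, rfl⟩
    have hnext : postNext t c ht h (orbitPoint t c ht h j (q - 1)) =
        (lorenzMarkedMap t c ht h).val 1 :=
      dif_pos ((mem_range_c0_iff t c ht h _).mpr hpos)
    have e := postSolution_next t c ht h (orbitPoint t c ht h j (q - 1))
    rw [hnext, hpos, side, if_neg (lt_irrefl c)] at e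
    -- At `c` the recurrence gives `Φ(c) = (Φ(c₁,₂) + 1 - c) / t`; subtracting the derivative of the
    -- jump leaves `-1/t` times the deviation of index `1`.
    refine ⟨t ^ (q - 1), t⁻¹, pow_pos ht0 _, ?_, ?_⟩
    · exact (inv_lt_one_of_one_lt₀ ht).trans_le (one_le_pow₀ ht.le)
    · have hR : (fun w => (lorenzDeformation t c ht h).R rel w j) =
          fun w => (branches c w)^[q - 1] (w j) - jump w := by
        funext w
        simp only [Deformation.R, hr]
        rfl
      rw [hR]
      refine ((hasFDerivAt_iterate hlt).sub (hasFDerivAt_jump (w₀ := cval t c)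
        (by rw [slope_cval]; exact ht'))).congr_fderiv ?_
      rw [slope_cval, jump_cval t c ht]
      refine ContinuousLinearMap.ext fun v => ?_
      simp only [smul_apply, add_apply,
        sub_apply, smul_eq_mul]
      simp only [deviation, smul_apply, sub_apply,
        smul_eq_mul, e]
      push_cast
      field_simp
      ring
  | preperiodic l q =>
    rw [hr] at hj
    obtain ⟨hl, hlq, he, hn, -⟩ := hj
    have hlt : ∀ k < q, (lorenzMarkedMap t c ht h).g^[k] ((lorenzMarkedMap t c ht h).c1 j) ∉
        Set.range (lorenzMarkedMap t c ht h).c0 := fun k hk => hn (k + 1) (by omega) (by omega)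
    have hq := hasFDerivAt_iterate (n := q - 1) fun k hk => hlt k (by omega)
    have hl := hasFDerivAt_iterate (n := l - 1) fun k hk => hlt k (by omega)
    have e : orbitPoint t c ht h j (q - 1) = orbitPoint t c ht h j (l - 1) := by
      apply Subtype.ext
      rw [coe_orbitPoint fun k hk => hlt k (by omega),
        coe_orbitPoint fun k hk => hlt k (by omega), he]
    have hα : 0 < t ^ (q - 1) - t ^ (l - 1) :=
      sub_pos.mpr (pow_lt_pow_right₀ ht (by omega))
    -- The two orbit points coincide, so their `Φ` terms cancel.
    refine ⟨_, 0, hα, hα, ?_⟩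
    have hR : (fun w => (lorenzDeformation t c ht h).R rel w j) =
        fun w => (branches c w)^[q - 1] (w j) - (branches c w)^[l - 1] (w j) := by
      funext w
      simp only [Deformation.R, hr]
      rfl
    rw [hR]
    refine (hq.sub hl).congr_fderiv ?_
    rw [e]
    refine ContinuousLinearMap.ext fun v => ?_
    simp only [smul_apply, add_apply,
      sub_apply, smul_eq_mul]
    push_cast
    ring

theorem deriv_iterate_of_satisfies {r : Relation 2} {j : Fin 2}
    (hj : (lorenzMarkedMap t c ht h).Satisfies j r) :
    deriv (lorenzMarkedMap t c ht h).g^[r.time - 1] ((lorenzMarkedMap t c ht h).c1 j) =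
      (t : ℂ) ^ (r.time - 1) := by
  have hn : ∀ k < r.time - 1,
      (lorenzMarkedMap t c ht h).g^[k] ((lorenzMarkedMap t c ht h).c1 j) ∉
        Set.range (lorenzMarkedMap t c ht h).c0 := by
    intro k hk
    cases r with
    | periodic q μ =>
      have hk' : k < q - 1 := hk
      exact hj.2.2 (k + 1) (by omega) (by omega)
    | preperiodic l q =>
      have hk' : k < q - 1 := hk
      exact hj.2.2.2.1 (k + 1) (by omega) (by omega)
  have := hasDerivAt_branches_iterate (c := c) (w := cval t c) (z := cval t c j) fun k hk =>
    iterate_re_ne (h := h) (ht := ht) (j := j) fun i hi => hn i (lt_of_le_of_lt hi hk)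
  rw [slope_cval] at this
  exact this.deriv

/-- The row of index `1` is `(α 1 - β 1)` times a deviation, so `β 0` drops out. The deviations form
the identity minus the rank-one matrix `Φ ⊗ τ`, with determinant `1 - τ(Φ)`. -/
theorem det_pi_deviation (α β : Fin 2 → ℝ) :
    LinearMap.det ((ContinuousLinearMap.pi fun j =>
        (α j : ℂ) • deviation t c ht h j - (β j : ℂ) • deviation t c ht h 1 :
          (Fin 2 → ℂ) →L[ℂ] (Fin 2 → ℂ)) : (Fin 2 → ℂ) →ₗ[ℂ] (Fin 2 → ℂ)) =
      ((α 0 * (α 1 - β 1) *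
        (1 - (postSolution t c ht h ((lorenzMarkedMap t c ht h).val 0) -
          postSolution t c ht h ((lorenzMarkedMap t c ht h).val 1)) / 2) : ℝ) : ℂ) := by
  rw [← LinearMap.det_toMatrix', Matrix.det_fin_two]
  simp [LinearMap.toMatrix'_apply, deviation, slopeDeriv_apply]
  ring

variable (t c ht h)

theorem positivelyTransversal : (lorenzDeformation t c ht h).PositivelyTransversal := by
  refine ⟨⟨fun j => ((lorenzMarkedMap t c ht h).exists_satisfies j).choose,
    fun j => ((lorenzMarkedMap t c ht h).exists_satisfies j).choose_spec⟩, fun rel hrel => ?_⟩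
  choose α β hα hβ hR using fun j => exists_hasFDerivAt_R (hrel j)
  have ht0 : 0 < t := by linarith
  have hδ := (isAffineTransfer t c ht h).boundedSolution_lt ht
  refine ⟨ContinuousLinearMap.pi fun j =>
      (α j : ℂ) • deviation t c ht h j - (β j : ℂ) • deviation t c ht h 1,
    α 0 * (α 1 - β 1) * (1 - (postSolution t c ht h ((lorenzMarkedMap t c ht h).val 0) -
      postSolution t c ht h ((lorenzMarkedMap t c ht h).val 1)) / 2) /
      ∏ j, t ^ ((rel j).time - 1), hasFDerivAt_pi.mpr hR, ?_, ?_⟩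
  · refine div_pos (mul_pos (mul_pos (hα 0) (sub_pos.mpr (hβ 1))) (sub_pos.mpr hδ)) ?_
    exact Finset.prod_pos fun j _ => pow_pos ht0 _
  · rw [det_pi_deviation, Finset.prod_congr rfl fun j _ => deriv_iterate_of_satisfies (hrel j)]
    push_cast
    rfl

end Lorenz

end LorenzTransversality

end

theorem mainTheorem12 (t c : ℝ) (ht : 1 < t) (ht2 : t ≤ 2) (hc : -1 < c) (hc1 : c < 1)
    (h : ∀ j, LorenzTransversality.IsEventuallyPeriodic t c j) :
    (∃! A, LorenzTransversality.IsTransferOperator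
        (LorenzTransversality.lorenzDeformation t c ht h) A) ∧
    (∀ A, LorenzTransversality.IsTransferOperator
        (LorenzTransversality.lorenzDeformation t c ht h) A →
      spectralRadius ℂ A ≤ 1 ∧ ¬ Module.End.HasEigenvalue A 1) ∧
    (LorenzTransversality.lorenzDeformation t c ht h).PositivelyTransversal := by
  have hT := LorenzTransversality.isTransferOperator_lorenzTransfer t c ht h
  have hA := LorenzTransversality.isAffineTransfer t c ht h
  refine ⟨⟨_, hT, fun B hB =>
    LorenzTransversality.isTransferOperator_unique t c ht h hB hT⟩, fun A hA' => ?_,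
    LorenzTransversality.positivelyTransversal t c ht h⟩
  rw [LorenzTransversality.isTransferOperator_unique t c ht h hA' hT]
  exact ⟨hA.spectralRadius_le ht, hA.not_hasEigenvalue_one ht⟩
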